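/- Let $G$ be a compact, connected, semisimple (real, finite-dimensional) Lie group with Lie algebra $\mathfrak g$, where semisimple means that the Killing form $B(X,Y)=\operatorname{tr}(\operatorname{ad}X\circ\operatorname{ad}Y)$ of $\mathfrak g$ is nondegenerate. Let $\mathfrak g^*$ be the dual of $\mathfrak g$, let $\mathrm{Ad}$ be the adjoint action of $G$ on $\mathfrak g$, let $\mathrm{Ad}^*_g\alpha=\alpha\circ \mathrm{Ad}_{g^{-1}}$ be the coadjoint action on $\mathfrak g^*$, and let $B^\flat:\mathfrak g\to\mathfrak g^*$, $B^\flat(X)(Y)=B(X,Y)$. For $X\in\mathfrak g$ write $O_X$ for the adjoint orbit of $X$, and for $\alpha\in\mathfrak g^*$ write $O_\alpha$ for the coadjoint orbit of $\alpha$. Then: 1. $B^\flat$ is a linear isomorphism and $B^\flat\circ \mathrm{Ad}_g=\mathrm{Ad}^*_g\circ B^\flat$ for all $g\in G$. 2. $B^\flat$ descends to a bijection $\widehat{B^\flat}:\mathfrak g/G\to\mathfrak g^*/G$, $[X]\mapsto[B^\flat X]$, of the orbit spaces, and $\widehat{B^\flat}$ is a diffeomorphism for the quotient smooth structures, that is,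 for the finest diffeologies that make the projections $\mathfrak g\to\mathfrak g/G$ and $\mathfrak g^*\to\mathfrak g^*/G$ smooth. 3. For every $X\in\mathfrak g$, with $\alpha=B^\flat(X)$, the orbits $O_X\subset\mathfrak g$ and $O_\alpha\subset\mathfrak g^*$ are embedded submanifolds; the tangent space $T_\nu O_\alpha$ at $\nu\in O_\alpha$ is the space of all values $\xi_{\mathfrak g^*}(\nu)$, $\xi\in\mathfrak g$, of fundamental vector fields of the coadjoint action; the formula $\omega_\nu(\xi_{\mathfrak g^*}(\nu),\eta_{\mathfrak g^*}(\nu))=-\nu([\xi,\eta])$ defines a symplectic form $\omega$ on $O_\alpha$ (the Kirillov–Kostant–Souriau form); $B^\flat$ restricts to a diffeomorphism $F:O_X\to O_\alpha$; and $F^*\omega$ is a symplectic form on $O_X$. Thus $F$ is a symplectomorphism from $(O_X,F^*\omega)$ onto $(O_\alpha,\omega)$. -/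

import Mathlib

open Manifold ContDiff Diffeology

noncomputable section

/-! ### The Lie algebra of a Lie group as a normed space

The tangent space at the identity is, as a topological vector space, the model space `E`. It gets
the norm of `E`, without changing its topology and its vector space structure. -/

section LieAlgebra

variable {E : Type*} [NormedAddCommGroup E] [NormedSpace ℝ E]
  {G : Type*} [TopologicalSpace G] [ChartedSpace E G] [Group G]

instance instNormGroupLieAlgebra : Norm (GroupLieAlgebra 𝓘(ℝ, E) G) :=
  ⟨fun v => norm (show E from v)⟩

theorem groupLieAlgebra_normedSpaceCore : NormedSpace.Core ℝ (GroupLieAlgebra 𝓘(ℝ, E) G) where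
  norm_nonneg v := norm_nonneg (show E from v)
  norm_smul c v := norm_smul c (show E from v)
  norm_triangle v w := norm_add_le (show E from v) (show E from w)
  norm_eq_zero_iff v := norm_eq_zero (a := (show E from v))

theorem groupLieAlgebra_topology_eq :
    (inferInstance : TopologicalSpace (GroupLieAlgebra 𝓘(ℝ, E) G)) =
      (PseudoEMetricSpace.ofSeminormedSpaceCore (groupLieAlgebra_normedSpaceCore
        (E := E) (G := G)).toCore).toUniformSpace.toTopologicalSpace := by
  let t : NormedAddCommGroup (GroupLieAlgebra 𝓘(ℝ, E) G) :=
    NormedAddCommGroup.ofCore groupLieAlgebra_normedSpaceCore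
  have hE : @IsTopologicalAddGroup (GroupLieAlgebra 𝓘(ℝ, E) G)
    (instTopologicalSpaceTangentSpace 𝓘(ℝ, E) (1 : G)) _ := inferInstance
  have ht : @IsTopologicalAddGroup (GroupLieAlgebra 𝓘(ℝ, E) G)
    t.toPseudoMetricSpace.toUniformSpace.toTopologicalSpace _ :=
    t.toSeminormedAddCommGroup.toIsTopologicalAddGroup
  refine IsTopologicalAddGroup.ext hE ht ?_
  have h1 := Metric.nhds_basis_ball (x := (0 : E))
  have h2 := Metric.nhds_basis_ball (x := (0 : GroupLieAlgebra 𝓘(ℝ, E) G))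
  refine Filter.HasBasis.ext h1 h2 ?_ ?_
  · intro r hr
    exact ⟨r, hr, fun v hv =>
      have hv' : ‖v‖ < r := (mem_ball_zero_iff (E := GroupLieAlgebra 𝓘(ℝ, E) G)).1 hv
      (mem_ball_zero_iff (E := E)).2 hv'⟩
  · intro r hr
    exact ⟨r, hr, fun v hv =>
      have hv' : ‖v‖ < r := (mem_ball_zero_iff (E := E)).1 hv
      (mem_ball_zero_iff (E := GroupLieAlgebra 𝓘(ℝ, E) G)).2 hv'⟩

instance instNormedAddCommGroupGroupLieAlgebra :
    NormedAddCommGroup (GroupLieAlgebra 𝓘(ℝ, E) G) :=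
  NormedAddCommGroup.ofCoreReplaceTopology groupLieAlgebra_normedSpaceCore
    groupLieAlgebra_topology_eq

instance instNormedSpaceGroupLieAlgebra : NormedSpace ℝ (GroupLieAlgebra 𝓘(ℝ, E) G) where
  norm_smul_le c v := (norm_smul c (show E from v)).le

instance instFiniteDimensionalGroupLieAlgebra [FiniteDimensional ℝ E] :
    FiniteDimensional ℝ (GroupLieAlgebra 𝓘(ℝ, E) G) :=
  inferInstanceAs (FiniteDimensional ℝ E)

instance instLEInftyMinSmoothness : ENat.LEInfty (minSmoothness ℝ 3) :=
  ⟨by rw [minSmoothness_of_isRCLikeNormedField]; exact ENat.LEInfty.out⟩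

end LieAlgebra

/-! ### The adjoint and the coadjoint action, and the Killing form -/

section Adjoint

variable (E : Type*) [NormedAddCommGroup E] [NormedSpace ℝ E]
  (G : Type*) [TopologicalSpace G] [ChartedSpace E G] [Group G]

/-- `Ad g` is the derivative at the identity of `x ↦ g x g⁻¹`. -/
def adMap (g : G) : GroupLieAlgebra 𝓘(ℝ, E) G →L[ℝ] GroupLieAlgebra 𝓘(ℝ, E) G :=
  (mfderiv 𝓘(ℝ, E) 𝓘(ℝ, E) (fun x : G => g * x * g⁻¹) 1 :)

variable [LieGroup 𝓘(ℝ, E) ∞ G]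

/-- The adjoint action of a Lie group on its Lie algebra. -/
def Ad : G →* (GroupLieAlgebra 𝓘(ℝ, E) G →L[ℝ] GroupLieAlgebra 𝓘(ℝ, E) G) where
  toFun := adMap E G
  map_one' := by
    have h : (fun x : G => (1 : G) * x * (1 : G)⁻¹) = id := by ext x; simp
    unfold adMap
    rw [h]
    exact mfderiv_id
  map_mul' g h := by
    have key : ∀ a b : G, MDifferentiableAt 𝓘(ℝ, E) 𝓘(ℝ, E) (fun x : G => a * x * a⁻¹) b :=
      fun a b => ((contMDiff_mul_right (I := 𝓘(ℝ, E)) (n := ∞) (a := a⁻¹)).comp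
        (contMDiff_mul_left (I := 𝓘(ℝ, E)) (n := ∞) (a := a))).contMDiffAt.mdifferentiableAt
          (by simp)
    have hc : (fun x : G => (g * h) * x * (g * h)⁻¹) =
        (fun x : G => g * x * g⁻¹) ∘ (fun x : G => h * x * h⁻¹) := by
      ext x; simp [mul_assoc]
    have hm := mfderiv_comp (1 : G) (key g (h * 1 * h⁻¹)) (key h 1)
    rw [← hc] at hm
    have e : ∀ y : G, y = 1 → ∀ v : E,
        (mfderiv 𝓘(ℝ, E) 𝓘(ℝ, E) (fun x : G => g * x * g⁻¹) y : E →L[ℝ] E) v =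
          (mfderiv 𝓘(ℝ, E) 𝓘(ℝ, E) (fun x : G => g * x * g⁻¹) 1 : E →L[ℝ] E) v := by
      rintro _ rfl v
      rfl
    refine ContinuousLinearMap.ext fun v => ?_
    exact (congrArg (fun L : E →L[ℝ] E => L v) hm).trans (e _ (by simp) _)

/-- The coadjoint action of a Lie group on the dual of its Lie algebra,
`(Ad* g α)(Y) = α (Ad g⁻¹ Y)`. -/
def coAd : G →* (StrongDual ℝ (GroupLieAlgebra 𝓘(ℝ, E) G) →L[ℝ]
    StrongDual ℝ (GroupLieAlgebra 𝓘(ℝ, E) G)) where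
  toFun g := ContinuousLinearMap.precomp ℝ (Ad E G g⁻¹)
  map_one' := by
    ext α Y
    simp
  map_mul' g h := by
    ext α Y
    simp

/-- The map `B♭ : 𝔤 → 𝔤*`, `B♭ X Y = B(X, Y)` with the Killing form `B(X, Y) = tr (ad X ∘ ad Y)`. -/
def killingFlat [FiniteDimensional ℝ E] [CompleteSpace E] :
    GroupLieAlgebra 𝓘(ℝ, E) G →ₗ[ℝ] StrongDual ℝ (GroupLieAlgebra 𝓘(ℝ, E) G) :=
  (LinearMap.toContinuousLinearMap (𝕜 := ℝ) (E := GroupLieAlgebra 𝓘(ℝ, E) G) (F' := ℝ)).toLinearMap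
    ∘ₗ killingForm ℝ (GroupLieAlgebra 𝓘(ℝ, E) G)

end Adjoint

/-! ### Orbits and orbit spaces of a linear action -/

section Orbits

variable {G : Type*} [Group G] {V : Type*} [NormedAddCommGroup V] [NormedSpace ℝ V]

/-- The orbit of `v` under the linear action `ρ`. -/
def orbit (ρ : G →* (V →L[ℝ] V)) (v : V) : Set V :=
  Set.range fun g => ρ g v

/-- Two vectors are equivalent when they lie in the same orbit. -/
def orbitSetoid (ρ : G →* (V →L[ℝ] V)) : Setoid V where
  r v w := w ∈ orbit ρ v
  iseqv :=
    { refl := fun v => ⟨1, by simp⟩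
      symm := by
        rintro v _ ⟨g, rfl⟩
        refine ⟨g⁻¹, ?_⟩
        change (ρ g⁻¹ * ρ g) v = v
        rw [← map_mul]
        simp
      trans := by
        rintro v _ _ ⟨g, rfl⟩ ⟨h, rfl⟩
        refine ⟨h * g, ?_⟩
        simp }

/-- The orbit space `V / G`. -/
def OrbitSpace (ρ : G →* (V →L[ℝ] V)) : Type _ :=
  Quotient (orbitSetoid ρ)

/-- The projection `π : V → V / G`. -/
def OrbitSpace.mk (ρ : G →* (V →L[ℝ] V)) (v : V) : OrbitSpace ρ :=
  Quotient.mk (orbitSetoid ρ) v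

/-- The quotient smooth structure on `V / G`: the finest diffeology for which `π` is smooth. Its
plots are the maps that locally lift to smooth maps into `V`. -/
instance instDiffeologicalSpaceOrbitSpace (ρ : G →* (V →L[ℝ] V)) :
    DiffeologicalSpace (OrbitSpace ρ) :=
  DiffeologicalSpace.generateFrom
    {q | ∃ p : EuclideanSpace ℝ (Fin q.1) → V, ContDiff ℝ ∞ p ∧ q.2 = OrbitSpace.mk ρ ∘ p}

/-- The value at `v` of the fundamental vector field of the action `ρ` attached to `ξ ∈ 𝔤`:
the derivative of the orbit map `g ↦ ρ g v` at the identity in the direction `ξ`. -/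
def fundamentalField {E : Type*} [NormedAddCommGroup E] [NormedSpace ℝ E]
    [TopologicalSpace G] [ChartedSpace E G] (ρ : G →* (V →L[ℝ] V))
    (ξ : GroupLieAlgebra 𝓘(ℝ, E) G) (v : V) : V :=
  mfderiv 𝓘(ℝ, E) 𝓘(ℝ, V) (fun g : G => ρ g v) 1 ξ

end Orbits

/-! ### Embedded submanifolds of a normed space -/

section Submanifold

variable {V : Type*} [NormedAddCommGroup V] [NormedSpace ℝ V]

/-- A manifold structure on `S ⊆ V` (with the subspace topology) that makes `S` an embedded
submanifold: the inclusion is a smooth embedding. Such a structure is unique up to equivalence of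
atlases. -/
def IsSubmanifoldStructure (S : Set V) (d : ℕ) [ChartedSpace (EuclideanSpace ℝ (Fin d)) S] : Prop :=
  IsManifold (𝓡 d) ∞ S ∧ IsSmoothEmbedding (𝓡 d) 𝓘(ℝ, V) ∞ (Subtype.val : S → V)

/-- `S` is an embedded submanifold of `V`. -/
def IsEmbeddedSubmanifold (S : Set V) : Prop :=
  ∃ (d : ℕ) (_ : ChartedSpace (EuclideanSpace ℝ (Fin d)) S), IsSubmanifoldStructure S d

/-- The derivative of the inclusion `S → V` at `p`, which identifies `T_p S` with a subspace
of `V`. -/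
def tangentInclusion (S : Set V) (d : ℕ) [ChartedSpace (EuclideanSpace ℝ (Fin d)) S] (p : S) :
    TangentSpace (𝓡 d) p →L[ℝ] V :=
  mfderiv (𝓡 d) 𝓘(ℝ, V) (Subtype.val : S → V) p

end Submanifold

/-! ### Symplectic forms on manifolds -/

section Symplectic

variable {E : Type*} [NormedAddCommGroup E] [NormedSpace ℝ E]
  {M : Type*} [TopologicalSpace M] [ChartedSpace E M]
  {E' : Type*} [NormedAddCommGroup E'] [NormedSpace ℝ E']
  {M' : Type*} [TopologicalSpace M'] [ChartedSpace E' M']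

variable (E M) in
/-- A (not necessarily continuous) 2-form on `M`: an alternating bilinear form on every tangent
space. -/
abbrev TwoForm : Type _ :=
  ∀ p : M, TangentSpace 𝓘(ℝ, E) p [⋀^Fin 2]→L[ℝ] ℝ

/-- The 2-form `σ` in the chart at `x`, that is, its pullback by the inverse of the chart. It is
meaningful on the target of the chart. -/
def TwoForm.inChart (σ : TwoForm E M) (x : M) : E → E [⋀^Fin 2]→L[ℝ] ℝ := fun y =>
  (σ ((extChartAt 𝓘(ℝ, E) x).symm y)).compContinuousLinearMap
    (mfderiv 𝓘(ℝ, E) 𝓘(ℝ, E) (extChartAt 𝓘(ℝ, E) x).symm y : E →L[ℝ] _)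

/-- A symplectic form: a smooth, closed and nondegenerate 2-form. -/
structure TwoForm.IsSymplectic (σ : TwoForm E M) : Prop where
  smooth : ∀ x : M, ContDiffOn ℝ ∞ (σ.inChart x) (extChartAt 𝓘(ℝ, E) x).target
  closed : ∀ x : M, ∀ y ∈ (extChartAt 𝓘(ℝ, E) x).target, extDeriv (σ.inChart x) y = 0
  nondegenerate : ∀ (p : M) (u : TangentSpace 𝓘(ℝ, E) p),
    (∀ v : TangentSpace 𝓘(ℝ, E) p, σ p ![u, v] = 0) → u = 0

/-- The pullback of a 2-form by a map. -/
def TwoForm.pullback (F : M → M') (σ : TwoForm E' M') : TwoForm E M := fun p =>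
  (σ (F p)).compContinuousLinearMap (mfderiv 𝓘(ℝ, E) 𝓘(ℝ, E') F p)

/-- A diffeomorphism `F : (M, Ω) → (M', σ)` is a symplectomorphism when `F^* σ = Ω`. -/
def IsSymplectomorphism (F : M ≃ₘ^∞⟮𝓘(ℝ, E), 𝓘(ℝ, E')⟯ M') (Ω : TwoForm E M)
    (σ : TwoForm E' M') : Prop :=
  TwoForm.pullback F σ = Ω

end Symplectic

section KKS

variable {E : Type*} [NormedAddCommGroup E] [NormedSpace ℝ E]
  {G : Type*} [TopologicalSpace G] [ChartedSpace E G] [Group G] [LieGroup 𝓘(ℝ, E) ∞ G]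

/-- The Kirillov-Kostant-Souriau form on the coadjoint orbit `O` of `α`, given on the values of
fundamental vector fields at `ν ∈ O` by `σ_ν (ξ_{𝔤*}(ν), η_{𝔤*}(ν)) = -ν([ξ, η])`. -/
def IsKKSForm (α : StrongDual ℝ (GroupLieAlgebra 𝓘(ℝ, E) G)) (d : ℕ)
    [ChartedSpace (EuclideanSpace ℝ (Fin d)) (orbit (coAd E G) α)]
    (σ : TwoForm (EuclideanSpace ℝ (Fin d)) (orbit (coAd E G) α)) : Prop :=
  ∀ (ν : orbit (coAd E G) α) (u v : TangentSpace (𝓡 d) ν) (ξ η : GroupLieAlgebra 𝓘(ℝ, E) G),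
    tangentInclusion _ d ν u = fundamentalField (coAd E G) ξ ν.1 →
    tangentInclusion _ d ν v = fundamentalField (coAd E G) η ν.1 →
    σ ν ![u, v] = -(ν.1 ⁅ξ, η⁆)

end KKS

end

/-! `Ad g` is an automorphism of the Lie algebra, so it preserves the Killing form, and this is the
equivariance of `B♭`; nondegeneracy and equality of dimensions make `B♭` bijective. A linear
isomorphism intertwining two actions carries orbits onto orbits, hence descends to the orbit spaces
with a smooth inverse. It also restricts to diffeomorphisms between orbits, once these are known to
be embedded submanifolds. The work lies in the geometry of the orbits and in the closedness of the
KKS form.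

Orbits. By equivariance, an orbit map `g ↦ ρ g v` has constant rank. The constant rank theorem
(`exists_factorization_of_rank_le`) therefore makes linear coordinates `P` on the image invertible
by a smooth map which lifts to the group. Compactness of `G` (`image_mem_nhdsWithin_orbit`) makes
the images of small neighbourhoods of `1` neighbourhoods in the subspace topology of the orbit. The
outcome, `exists_orbit_section`, is a smooth local section; it yields slice charts, injectivity of
the tangent inclusion and the description of tangent spaces by fundamental fields.

The form. From `d Ad = ad` (`mfderiv_Ad_one`) one gets `ξ_{𝔤*}(ν)(Y) = -ν([ξ, Y])`. So the KKS
expression depends only on the tangent vectors, and a vector in its kernel vanishes. For closedness,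
write a moving point of the orbit as `Ad*_{g(y)} (B♭ X)` by a local section. The pulled back KKS
form is then `dβ`, where `β = B(X, g⁻¹ dg)` pairs `X` with the Maurer–Cartan form. In
`contDiffAt_and_extDeriv_eq_zero_of_kks`, `β` is written as `tr (ad X ∘ Ad(g)⁻¹ d Ad(g))`, which is
calculus in a fixed vector space. The argument applies to any smooth map into the orbit, so it
covers `ω` and `F^*ω` alike. -/

/-! ### The constant rank theorem -/

section ConstantRank

open Filter Topology

variable {E : Type*} [NormedAddCommGroup E] [NormedSpace ℝ E] [FiniteDimensional ℝ E]
  {V : Type*} [NormedAddCommGroup V] [NormedSpace ℝ V] [FiniteDimensional ℝ V]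

/-- Linear coordinates adapted to a linear map `L : E → V`: the projection `P` restricts to
coordinates on the range, and `Q` is a projection onto the kernel. -/
theorem exists_coordinates_range_ker (L : E →L[ℝ] V) {d : ℕ}
    (hd : Module.finrank ℝ L.toLinearMap.range = d) :
    ∃ (P : V →L[ℝ] EuclideanSpace ℝ (Fin d)) (Q : E →L[ℝ] L.toLinearMap.ker)
      (Φ : E ≃L[ℝ] EuclideanSpace ℝ (Fin d) × L.toLinearMap.ker),
      ∀ x, Φ x = (P (L x), Q x) := by
  let e : L.toLinearMap.range ≃ₗ[ℝ] EuclideanSpace ℝ (Fin d) :=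
    LinearEquiv.ofFinrankEq _ _ (by simp [hd])
  obtain ⟨p, hp⟩ := LinearMap.exists_leftInverse_of_injective L.toLinearMap.range.subtype
    (Submodule.ker_subtype _)
  obtain ⟨q, hq⟩ := LinearMap.exists_leftInverse_of_injective L.toLinearMap.ker.subtype
    (Submodule.ker_subtype _)
  have hp' : ∀ y : L.toLinearMap.range, p y = y := fun y => LinearMap.congr_fun hp y
  have hq' : ∀ y : L.toLinearMap.ker, q y = y := fun y => LinearMap.congr_fun hq y
  let P : V →ₗ[ℝ] EuclideanSpace ℝ (Fin d) := e.toLinearMap ∘ₗ p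
  have hPL : ∀ x, P (L x) = e ⟨L x, x, rfl⟩ := fun x => congrArg e (hp' ⟨L x, x, rfl⟩)
  let φ : E →ₗ[ℝ] EuclideanSpace ℝ (Fin d) × L.toLinearMap.ker :=
    (P ∘ₗ L.toLinearMap).prod q
  have hφ : Function.Bijective φ := by
    constructor
    · rw [← LinearMap.ker_eq_bot, LinearMap.ker_eq_bot']
      intro x hx
      have h1 : P (L x) = 0 := congrArg Prod.fst hx
      have h2 : q x = 0 := congrArg Prod.snd hx
      rw [hPL, map_eq_zero_iff e e.injective] at h1
      have h3 : L x = 0 := congrArg Subtype.val h1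
      have h4 := hq' ⟨x, h3⟩
      rw [h2] at h4
      exact (congrArg Subtype.val h4).symm
    · rintro ⟨t, k⟩
      obtain ⟨x, hx⟩ : ∃ x, P (L x) = t := by
        obtain ⟨⟨_, x, rfl⟩, h⟩ := e.surjective t
        exact ⟨x, (hPL x).trans h⟩
      refine ⟨x + ((k - q x : L.toLinearMap.ker) : E), ?_⟩
      have h0 : L ((k - q x : L.toLinearMap.ker) : E) = 0 := (k - q x).2
      refine Prod.ext ?_ ?_
      · change P (L (x + ((k - q x : L.toLinearMap.ker) : E))) = t
        rw [map_add, h0, add_zero, hx]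
      · change q (x + ((k - q x : L.toLinearMap.ker) : E)) = k
        rw [map_add, hq', add_sub_cancel]
  exact ⟨P.toContinuousLinearMap, q.toContinuousLinearMap,
    (LinearEquiv.ofBijective φ hφ).toContinuousLinearEquiv, fun x => rfl⟩

/-- The constant rank theorem: near a point where the rank of its derivative does not increase, the
map `f` factors through the linear coordinates `P ∘ f`. -/
theorem exists_factorization_of_rank_le {f : E → V} {e : E}
    (hf' : ∀ᶠ x in 𝓝 e, ContDiffAt ℝ ∞ f x) {d : ℕ}
    (hd : Module.finrank ℝ (fderiv ℝ f e).toLinearMap.range = d)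
    (hr : ∀ᶠ x in 𝓝 e, Module.finrank ℝ (fderiv ℝ f x).toLinearMap.range ≤ d) :
    ∃ (P : V →L[ℝ] EuclideanSpace ℝ (Fin d)) (γ : EuclideanSpace ℝ (Fin d) → E),
      (∀ᶠ t in 𝓝 (P (f e)), ContDiffAt ℝ ∞ γ t) ∧ γ (P (f e)) = e ∧
      (∀ᶠ t in 𝓝 (P (f e)), P (f (γ t)) = t) ∧ ∀ᶠ x in 𝓝 e, f (γ (P (f x))) = f x := by
  obtain ⟨P, Q, Φ', hΦ'⟩ := exists_coordinates_range_ker (fderiv ℝ f e) hd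
  have hf : ContDiffAt ℝ ∞ f e := hf'.self_of_nhds
  let Φ : E → EuclideanSpace ℝ (Fin d) × (fderiv ℝ f e).toLinearMap.ker := fun x => (P (f x), Q x)
  have hΦ : ContDiffAt ℝ ∞ Φ e := (P.contDiff.contDiffAt.comp e hf).prodMk Q.contDiff.contDiffAt
  have hΦd : ∀ x, DifferentiableAt ℝ f x →
      HasFDerivAt Φ ((P.comp (fderiv ℝ f x)).prod Q) x := fun x hx =>
    (P.hasFDerivAt.comp x hx.hasFDerivAt).prodMk Q.hasFDerivAt
  have hfe : DifferentiableAt ℝ f e := hf.differentiableAt (by simp)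
  have hΦe : HasFDerivAt Φ (Φ' : E →L[ℝ] _) e := by
    convert hΦd e hfe using 1
    ext1 x
    exact hΦ' x
  let ψ := hΦ.localInverse hΦe (by simp)
  have hψ : ContDiffAt ℝ ∞ ψ (Φ e) := hΦ.to_localInverse hΦe (by simp)
  -- For order `∞`, smoothness at one point does not give smoothness nearby, since the neighbourhood
  -- may shrink with the order. Nearby points are treated directly: the derivative of `Φ` stays
  -- invertible there.
  have hψ' : ∀ᶠ z in 𝓝 (Φ e), ContDiffAt ℝ ∞ ψ z := by
    let T := hΦ.toOpenPartialHomeomorph Φ hΦe (by simp)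
    have hc : ContinuousAt (fderiv ℝ Φ) e := (hΦ.fderiv_right (m := 0) (by simp)).continuousAt
    have h1 : ∀ᶠ x in 𝓝 e, ∃ L : E ≃L[ℝ] EuclideanSpace ℝ (Fin d) × (fderiv ℝ f e).toLinearMap.ker,
        (L : E →L[ℝ] _) = fderiv ℝ Φ x :=
      hc.eventually (by rw [hΦe.fderiv]; exact ContinuousLinearEquiv.nhds Φ')
    have ht : Φ e ∈ T.target := hΦ.image_mem_toOpenPartialHomeomorph_target hΦe (by simp)
    have hTe : T.symm (Φ e) = e := hΦ.localInverse_apply_image hΦe (by simp)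
    have h2 : Tendsto T.symm (𝓝 (Φ e)) (𝓝 e) := by
      have := T.continuousAt_symm ht
      rwa [ContinuousAt, hTe] at this
    filter_upwards [T.open_target.mem_nhds ht, h2.eventually h1, h2.eventually hf']
      with z hz1 hz2 hz3
    obtain ⟨L, hL⟩ := hz2
    have h3 : ContDiffAt ℝ ∞ Φ (T.symm z) :=
      (P.contDiff.contDiffAt.comp _ hz3).prodMk Q.contDiff.contDiffAt
    refine T.contDiffAt_symm hz1 (f₀' := L) ?_ h3
    rw [hL]
    exact (h3.differentiableAt (by simp)).hasFDerivAt
  have hψe : ψ (Φ e) = e := hΦ.localInverse_apply_image hΦe (by simp)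
  have hright : ∀ᶠ z in 𝓝 (Φ e), Φ (ψ z) = z :=
    (hΦ.hasStrictFDerivAt' hΦe (by simp)).eventually_right_inverse
  have hleft : ∀ᶠ x in 𝓝 e, ψ (Φ x) = x :=
    (hΦ.hasStrictFDerivAt' hΦe (by simp)).eventually_left_inverse
  have hψt : Tendsto ψ (𝓝 (Φ e)) (𝓝 e) := by
    have := hψ.continuousAt.tendsto
    rwa [hψe] at this
  have hψd : ∀ᶠ z in 𝓝 (Φ e), DifferentiableAt ℝ ψ z :=
    ((hψ.of_le (m := 1) (by simp)).eventually (by simp)).mono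
      fun y hy => hy.differentiableAt (by simp)
  have hfd : ∀ᶠ x in 𝓝 e, DifferentiableAt ℝ f x :=
    ((hf.of_le (m := 1) (by simp)).eventually (by simp)).mono
      fun y hy => hy.differentiableAt (by simp)
  -- Since `P ∘ f ∘ ψ` is the first projection, `P` maps the range of `Df` onto a space of dimension
  -- `d`. The rank bound makes `P` injective on that range, and `P` kills `D(f ∘ ψ)(0, κ)`.
  have key : ∀ᶠ z in 𝓝 (Φ e), DifferentiableAt ℝ (f ∘ ψ) z ∧
      ∀ κ, fderiv ℝ (f ∘ ψ) z (0, κ) = 0 := by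
    filter_upwards [hright.eventually_nhds, hψd, hψt.eventually hfd, hψt.eventually hr]
      with z hz hψz hfz hrz
    have hcomp := hfz.hasFDerivAt.comp z hψz.hasFDerivAt
    refine ⟨hcomp.differentiableAt, fun κ => ?_⟩
    have hid : ((P.comp (fderiv ℝ f (ψ z))).prod Q).comp (fderiv ℝ ψ z) =
        ContinuousLinearMap.id ℝ _ :=
      ((hΦd _ hfz).comp z hψz.hasFDerivAt).unique
        ((hasFDerivAt_id z).congr_of_eventuallyEq hz)
    have hP : ∀ w, P (fderiv ℝ f (ψ z) (fderiv ℝ ψ z w)) = w.1 := fun w =>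
      congrArg Prod.fst (ContinuousLinearMap.ext_iff.1 hid w)
    let R := (fderiv ℝ f (ψ z)).toLinearMap.range
    let p : R →ₗ[ℝ] EuclideanSpace ℝ (Fin d) := P.toLinearMap ∘ₗ R.subtype
    have hsurj : Function.Surjective p := fun t =>
      ⟨⟨_, fderiv ℝ ψ z (t, 0), rfl⟩, hP (t, 0)⟩
    have hfin : Module.finrank ℝ R = Module.finrank ℝ (EuclideanSpace ℝ (Fin d)) := by
      refine le_antisymm (by simpa using hrz) (LinearMap.finrank_le_finrank_of_surjective hsurj)
    have hinj : Function.Injective p :=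
      (LinearMap.injective_iff_surjective_of_finrank_eq_finrank hfin).2 hsurj
    rw [hcomp.fderiv]
    have h0 : p ⟨_, fderiv ℝ ψ z (0, κ), rfl⟩ = p 0 := by
      rw [map_zero]; exact hP (0, κ)
    exact congrArg Subtype.val (hinj h0)
  obtain ⟨r, hr0, hball⟩ := Metric.eventually_nhds_iff_ball.1 key
  refine ⟨P, fun t => ψ (t, Q e), ?_, hψe, ?_, ?_⟩
  · have hc : Tendsto (fun t => (t, Q e)) (𝓝 (P (f e))) (𝓝 (Φ e)) :=
      (continuous_id.prodMk continuous_const).tendsto _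
    filter_upwards [hc.eventually hψ'] with t ht
    exact ContDiffAt.comp t (g := ψ) (f := fun t => (t, Q e)) ht
      (contDiffAt_id.prodMk contDiffAt_const)
  · have hc : Tendsto (fun t => (t, Q e)) (𝓝 (P (f e))) (𝓝 (Φ e)) :=
      (continuous_id.prodMk continuous_const).tendsto _
    filter_upwards [hc.eventually hright] with t ht
    exact congrArg Prod.fst ht
  · filter_upwards [hleft, hΦ.continuousAt.eventually (Metric.ball_mem_nhds _ hr0)] with x hx hxb
    have hxb' : P (f x) ∈ Metric.ball (P (f e)) r ∧ Q x ∈ Metric.ball (Q e) r := by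
      have : Φ x ∈ Metric.ball (P (f e), Q e) r := hxb
      rwa [← ball_prod_same] at this
    have hmem : ∀ s ∈ Metric.ball (Q e) r, (P (f x), s) ∈ Metric.ball (Φ e) r := fun s hs => by
      change (P (f x), s) ∈ Metric.ball (P (f e), Q e) r
      rw [← ball_prod_same]
      exact ⟨hxb'.1, hs⟩
    -- A ball for the sup norm is a product of balls, so its vertical slices are convex and `f ∘ ψ`
    -- is constant on each of them.
    have hder : ∀ s ∈ Metric.ball (Q e) r, HasFDerivAt (fun s => f (ψ (P (f x), s)))
        (0 : (fderiv ℝ f e).toLinearMap.ker →L[ℝ] V) s := fun s hs => by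
      obtain ⟨h1, h2⟩ := hball _ (hmem s hs)
      have h3 := h1.hasFDerivAt.comp s ((hasFDerivAt_const (P (f x)) s).prodMk (hasFDerivAt_id s))
      refine h3.congr_fderiv ?_
      ext1 κ
      exact h2 κ
    have hconst := (convex_ball (Q e) r).is_const_of_fderivWithin_eq_zero (𝕜 := ℝ)
      (f := fun s => f (ψ (P (f x), s)))
      (fun s hs => (hder s hs).differentiableAt.differentiableWithinAt)
      (fun s hs => (hder s hs).hasFDerivWithinAt.fderivWithin
        (Metric.isOpen_ball.uniqueDiffWithinAt hs))
      (Metric.mem_ball_self hr0) hxb'.2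
    exact hconst.trans (congrArg f hx)

end ConstantRank

/-! ### Second order calculus of a local multiplication -/

section ConjugationCalculus

open Filter Topology

variable {E : Type*} [NormedAddCommGroup E] [NormedSpace ℝ E]

/-- Calculus behind `d Ad = ad`: `m` is a local multiplication with unit `e`, and `A x` is the
derivative of the conjugation by `x`. -/
theorem fderiv_conj_eq_lieBracket {m : E × E → E} {e : E} (hm : ContDiffAt ℝ 2 m (e, e))
    (hr : ∀ᶠ x in 𝓝 e, m (x, e) = x) {A : E → E →L[ℝ] E} (hA : DifferentiableAt ℝ A e)
    (hA1 : A e = ContinuousLinearMap.id ℝ E)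
    (h : ∀ᶠ x in 𝓝 e, ∀ Y, fderiv ℝ m (x, e) (0, Y) = fderiv ℝ m (e, x) (A x Y, 0)) (ξ Y : E) :
    fderiv ℝ A e ξ Y = VectorField.lieBracket ℝ (fun x => fderiv ℝ m (x, e) (0, ξ))
      (fun x => fderiv ℝ m (x, e) (0, Y)) e := by
  have hD : DifferentiableAt ℝ (fderiv ℝ m) (e, e) :=
    (hm.fderiv_right (m := 1) (by norm_num)).differentiableAt (by simp)
  have hmd : DifferentiableAt ℝ m (e, e) := hm.differentiableAt (by simp)
  have hsymm : IsSymmSndFDerivAt ℝ m (e, e) :=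
    hm.isSymmSndFDerivAt (by rw [minSmoothness_of_isRCLikeNormedField])
  have hx : HasFDerivAt (fun x : E => (x, e)) (ContinuousLinearMap.inl ℝ E E) e :=
    hasFDerivAt_prodMk_left e e
  have hy : HasFDerivAt (fun x : E => (e, x)) (ContinuousLinearMap.inr ℝ E E) e :=
    hasFDerivAt_prodMk_right e e
  have hV : ∀ Z : E, HasFDerivAt (fun x => fderiv ℝ m (x, e) (0, Z))
      ((((fderiv ℝ (fderiv ℝ m) (e, e)).comp (ContinuousLinearMap.inl ℝ E E))).flip (0, Z)) e := by
    intro Z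
    have h1 := (hD.hasFDerivAt.comp (f := fun x : E => (x, e)) e hx).clm_apply
      (hasFDerivAt_const ((0, Z) : E × E) e)
    refine h1.congr_fderiv ?_
    ext w
    simp
  have hunit : ∀ w, fderiv ℝ m (e, e) (w, 0) = w := by
    intro w
    have h1 := (hmd.hasFDerivAt.comp (f := fun x : E => (x, e)) e hx).unique
      ((hasFDerivAt_id e).congr_of_eventuallyEq hr)
    exact ContinuousLinearMap.ext_iff.1 h1 w
  -- `hr` is about the right unit only; the other partial derivative comes from `h` at `x = e`,
  -- where `A e` is the identity.
  have hunit' : ∀ w, fderiv ℝ m (e, e) (0, w) = w := by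
    intro w
    have := h.self_of_nhds w
    rw [hA1] at this
    rw [this]
    exact hunit w
  have hAY : HasFDerivAt (fun x => ((A x Y, 0) : E × E))
      (((fderiv ℝ A e).flip Y).prod (0 : E →L[ℝ] E)) e := by
    refine HasFDerivAt.prodMk ?_ (hasFDerivAt_const _ _)
    have h1 := hA.hasFDerivAt.clm_apply (hasFDerivAt_const Y e)
    refine h1.congr_fderiv ?_
    ext w
    simp
  have hright := (hD.hasFDerivAt.comp (f := fun x : E => (e, x)) e hy).clm_apply hAY
  -- Both sides of `h` are differentiated at `e`. This gives `D²m((ξ,0),(0,Y)) = D²m((0,ξ),(Y,0)) +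
  -- DA(ξ)Y`; by symmetry of `D²m` the difference of the two second derivatives is the Lie bracket.
  have heq := (hV Y).unique (hright.congr_of_eventuallyEq (h.mono fun x hx => hx Y))
  have h2 := ContinuousLinearMap.ext_iff.1 heq ξ
  simp [hA1] at h2
  rw [hunit, hsymm.eq (0, ξ)] at h2
  rw [VectorField.lieBracket, (hV _).fderiv, (hV _).fderiv, hunit', hunit']
  simp [h2]

end ConjugationCalculus

/-! ### The group operations in the chart at the identity -/

section ChartAtOne

open Filter Topology

variable {E : Type*} [NormedAddCommGroup E] [NormedSpace ℝ E]
  {G : Type*} [TopologicalSpace G] [ChartedSpace E G] [Group G]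

/-- The derivative of a map between boundaryless manifolds, in the charts at a point and its
image. -/
theorem MDifferentiableAt.mfderiv_eq_fderiv_chart {E' : Type*} [NormedAddCommGroup E']
    [NormedSpace ℝ E'] {M : Type*} [TopologicalSpace M] [ChartedSpace E M]
    {M' : Type*} [TopologicalSpace M'] [ChartedSpace E' M'] {f : M → M'} {x : M}
    (hf : MDifferentiableAt 𝓘(ℝ, E) 𝓘(ℝ, E') f x) :
    (show E →L[ℝ] E' from mfderiv 𝓘(ℝ, E) 𝓘(ℝ, E') f x) =
      fderiv ℝ (extChartAt 𝓘(ℝ, E') (f x) ∘ f ∘ (extChartAt 𝓘(ℝ, E) x).symm)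
        (extChartAt 𝓘(ℝ, E) x x) := by
  have h : (mfderiv 𝓘(ℝ, E) 𝓘(ℝ, E') f x : E →L[ℝ] E') =
      fderivWithin ℝ (writtenInExtChartAt 𝓘(ℝ, E) 𝓘(ℝ, E') x f) (Set.range 𝓘(ℝ, E))
        (extChartAt 𝓘(ℝ, E) x x) := hf.mfderiv
  rw [modelWithCornersSelf_coe, Set.range_id, fderivWithin_univ] at h
  exact h

variable (E G) in
/-- The multiplication of `G` in the chart at `1`. -/
noncomputable def chartMul (p : E × E) : E :=
  extChartAt 𝓘(ℝ, E) (1 : G) ((extChartAt 𝓘(ℝ, E) (1 : G)).symm p.1 *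
    (extChartAt 𝓘(ℝ, E) (1 : G)).symm p.2)

variable (E) in
/-- Conjugation by `g` in the chart at `1`. -/
noncomputable def chartConj (g : G) (y : E) : E :=
  extChartAt 𝓘(ℝ, E) (1 : G) (g * (extChartAt 𝓘(ℝ, E) (1 : G)).symm y * g⁻¹)

theorem chartOne_symm : (extChartAt 𝓘(ℝ, E) (1 : G)).symm (extChartAt 𝓘(ℝ, E) (1 : G) 1) = 1 :=
  extChartAt_to_inv (I := 𝓘(ℝ, E)) (1 : G)

theorem contMDiffAt_chartOne {g : G} (hg : g = 1) :
    ContMDiffAt 𝓘(ℝ, E) 𝓘(ℝ, E) ∞ (extChartAt 𝓘(ℝ, E) (1 : G)) g := by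
  subst hg
  exact contMDiffAt_extChartAt

variable [LieGroup 𝓘(ℝ, E) ∞ G]

theorem contMDiff_conj (g : G) : ContMDiff 𝓘(ℝ, E) 𝓘(ℝ, E) ∞ (fun x : G => g * x * g⁻¹) :=
  (contMDiff_mul_right (I := 𝓘(ℝ, E)) (n := ∞) (a := g⁻¹)).comp
    (contMDiff_mul_left (I := 𝓘(ℝ, E)) (n := ∞) (a := g))

theorem contMDiffAt_chartOne_symm : ContMDiffAt 𝓘(ℝ, E) 𝓘(ℝ, E) ∞
    (extChartAt 𝓘(ℝ, E) (1 : G)).symm (extChartAt 𝓘(ℝ, E) (1 : G) 1) :=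
  (contMDiffOn_extChartAt_symm (I := 𝓘(ℝ, E)) (1 : G)).contMDiffAt
    (extChartAt_target_mem_nhds (I := 𝓘(ℝ, E)) (1 : G))

theorem contDiffAt_chartMul : ContDiffAt ℝ ∞ (chartMul E G)
    (extChartAt 𝓘(ℝ, E) (1 : G) 1, extChartAt 𝓘(ℝ, E) (1 : G) 1) := by
  rw [← contMDiffAt_iff_contDiffAt]
  set p := (extChartAt 𝓘(ℝ, E) (1 : G) 1, extChartAt 𝓘(ℝ, E) (1 : G) 1)
  have h1 : ContMDiffAt 𝓘(ℝ, E × E) 𝓘(ℝ, E) ∞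
      (fun p : E × E => (extChartAt 𝓘(ℝ, E) (1 : G)).symm p.1) p :=
    ContMDiffAt.comp (I' := 𝓘(ℝ, E)) p contMDiffAt_chartOne_symm contDiff_fst.contMDiff.contMDiffAt
  have h2 : ContMDiffAt 𝓘(ℝ, E × E) 𝓘(ℝ, E) ∞
      (fun p : E × E => (extChartAt 𝓘(ℝ, E) (1 : G)).symm p.2) p :=
    ContMDiffAt.comp (I' := 𝓘(ℝ, E)) p contMDiffAt_chartOne_symm contDiff_snd.contMDiff.contMDiffAt
  exact ContMDiffAt.comp (I' := 𝓘(ℝ, E)) p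
    (contMDiffAt_chartOne (by simp only [p, chartOne_symm, mul_one])) (h1.mul h2)

theorem contDiffAt_chartConj : ContDiffAt ℝ ∞
    (Function.uncurry fun x : E => chartConj E ((extChartAt 𝓘(ℝ, E) (1 : G)).symm x))
    (extChartAt 𝓘(ℝ, E) (1 : G) 1, extChartAt 𝓘(ℝ, E) (1 : G) 1) := by
  rw [← contMDiffAt_iff_contDiffAt]
  set p := (extChartAt 𝓘(ℝ, E) (1 : G) 1, extChartAt 𝓘(ℝ, E) (1 : G) 1)
  have h1 : ContMDiffAt 𝓘(ℝ, E × E) 𝓘(ℝ, E) ∞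
      (fun p : E × E => (extChartAt 𝓘(ℝ, E) (1 : G)).symm p.1) p :=
    ContMDiffAt.comp (I' := 𝓘(ℝ, E)) p contMDiffAt_chartOne_symm contDiff_fst.contMDiff.contMDiffAt
  have h2 : ContMDiffAt 𝓘(ℝ, E × E) 𝓘(ℝ, E) ∞
      (fun p : E × E => (extChartAt 𝓘(ℝ, E) (1 : G)).symm p.2) p :=
    ContMDiffAt.comp (I' := 𝓘(ℝ, E)) p contMDiffAt_chartOne_symm contDiff_snd.contMDiff.contMDiffAt
  exact ContMDiffAt.comp (I' := 𝓘(ℝ, E)) p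
    (contMDiffAt_chartOne (by simp only [p, chartOne_symm, mul_one, inv_one]))
    ((h1.mul h2).mul h1.inv)

/-- `Ad g` is the derivative of the conjugation by `g` in the chart at `1`. -/
theorem Ad_eq_fderiv_chartConj (g : G) (Y : E) :
    (Ad E G g Y : E) = fderiv ℝ (chartConj E g) (extChartAt 𝓘(ℝ, E) (1 : G) 1) Y := by
  have hd : MDifferentiableAt 𝓘(ℝ, E) 𝓘(ℝ, E) (fun x : G => g * x * g⁻¹) 1 :=
    (contMDiff_conj g).contMDiffAt.mdifferentiableAt (by simp)
  -- The base point `g * 1 * g⁻¹` equals `1` only propositionally and the chart depends on it, so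
  -- the equality is substituted for a variable `z`. The same device recurs below.
  have h1 : ∀ z : G, z = 1 →
      fderiv ℝ (extChartAt 𝓘(ℝ, E) z ∘ (fun x : G => g * x * g⁻¹) ∘
        (extChartAt 𝓘(ℝ, E) (1 : G)).symm) (extChartAt 𝓘(ℝ, E) (1 : G) 1) Y =
      fderiv ℝ (chartConj E g) (extChartAt 𝓘(ℝ, E) (1 : G) 1) Y := by
    rintro _ rfl
    rfl
  exact (ContinuousLinearMap.ext_iff.1 hd.mfderiv_eq_fderiv_chart Y).trans
    (h1 (g * 1 * g⁻¹) (by simp))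

/-- A left invariant vector field in the chart at `1`. -/
theorem mpullback_mulInvariantVectorField_chartOne (v : GroupLieAlgebra 𝓘(ℝ, E) G) {x : E}
    (hx : x ∈ (extChartAt 𝓘(ℝ, E) (1 : G)).target)
    (hx' : DifferentiableAt ℝ (chartMul E G) (x, extChartAt 𝓘(ℝ, E) (1 : G) 1)) :
    (VectorField.mpullbackWithin 𝓘(ℝ, E) 𝓘(ℝ, E) (extChartAt 𝓘(ℝ, E) (1 : G)).symm
      (mulInvariantVectorField v) (Set.range 𝓘(ℝ, E)) x : E) =
      fderiv ℝ (chartMul E G) (x, extChartAt 𝓘(ℝ, E) (1 : G) 1) ((0 : E), (v : E)) := by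
  set φ := extChartAt 𝓘(ℝ, E) (1 : G) with hφ
  set g := φ.symm x with hg
  have hgs : g ∈ φ.source := φ.map_target hx
  -- The pullback inverts the derivative of `φ.symm`; with that inverse equal to `Dφ`, the field in
  -- the chart is the derivative of `φ ∘ (g * ·)` at `1`.
  have hinv : (mfderivWithin 𝓘(ℝ, E) 𝓘(ℝ, E) φ.symm (Set.range 𝓘(ℝ, E)) x).inverse =
      mfderiv 𝓘(ℝ, E) 𝓘(ℝ, E) φ g :=
    ContinuousLinearMap.inverse_eq (mfderivWithin_extChartAt_symm_comp_mfderiv_extChartAt hx)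
      (mfderiv_extChartAt_comp_mfderivWithin_extChartAt_symm hx)
  have hdφ : MDifferentiableAt 𝓘(ℝ, E) 𝓘(ℝ, E) φ g := by
    refine mdifferentiableAt_extChartAt ?_
    rwa [hφ, extChartAt_source] at hgs
  have hdL : MDifferentiableAt 𝓘(ℝ, E) 𝓘(ℝ, E) (fun y : G => g * y) 1 :=
    (contMDiff_mul_left (I := 𝓘(ℝ, E)) (n := ∞) (a := g)).contMDiffAt.mdifferentiableAt (by simp)
  have hcomp := mfderiv_comp_of_eq hdφ hdL (mul_one g)
  have hdc : MDifferentiableAt 𝓘(ℝ, E) 𝓘(ℝ, E) (φ ∘ fun y : G => g * y) 1 := by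
    refine MDifferentiableAt.comp (I' := 𝓘(ℝ, E)) (1 : G) ?_ hdL
    rwa [mul_one]
  have h1 : fderiv ℝ (chartMul E G) (x, φ 1) ((0 : E), (v : E)) =
      (fderiv ℝ (fun y => chartMul E G (x, y)) (φ 1) v : E) := by
    have := (hx'.hasFDerivAt.comp (f := fun y : E => (x, y)) (φ 1)
      (hasFDerivAt_prodMk_right x (φ 1))).fderiv
    exact (ContinuousLinearMap.ext_iff.1 this v).symm
  rw [h1]
  have h2 : (mfderiv 𝓘(ℝ, E) 𝓘(ℝ, E) (φ ∘ fun y : G => g * y) 1 v : E) =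
      (fderiv ℝ (fun y => chartMul E G (x, y)) (φ 1) v : E) :=
    ContinuousLinearMap.ext_iff.1 hdc.mfderiv_eq_fderiv_chart v
  rw [← h2]
  have h3 : (VectorField.mpullbackWithin 𝓘(ℝ, E) 𝓘(ℝ, E) φ.symm
      (mulInvariantVectorField v) (Set.range 𝓘(ℝ, E)) x : E) =
      (mfderiv 𝓘(ℝ, E) 𝓘(ℝ, E) φ g (mfderiv 𝓘(ℝ, E) 𝓘(ℝ, E) (fun y : G => g * y) 1 v : E) : E) := by
    rw [VectorField.mpullbackWithin_apply, hinv]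
    rfl
  rw [h3]
  have h4 : ∀ z : G, z = g → ∀ w : E, (mfderiv 𝓘(ℝ, E) 𝓘(ℝ, E) φ z w : E) =
      (mfderiv 𝓘(ℝ, E) 𝓘(ℝ, E) φ g w : E) := by
    rintro _ rfl w
    rfl
  exact ((ContinuousLinearMap.ext_iff.1 hcomp v).trans (h4 _ (mul_one g) _)).symm

end ChartAtOne

/-! ### Smoothness of `Ad` and its derivative at the identity -/

section AdSmooth

open Filter Topology

variable {E : Type*} [NormedAddCommGroup E] [NormedSpace ℝ E]
  {G : Type*} [TopologicalSpace G] [ChartedSpace E G] [Group G]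

variable (E G) in
/-- The Lie algebra of `G` is, as a topological vector space, the model space. -/
noncomputable def groupLieAlgebraEquiv : GroupLieAlgebra 𝓘(ℝ, E) G ≃L[ℝ] E :=
  ContinuousLinearEquiv.refl ℝ E

variable (E G) in
/-- Endomorphisms of the Lie algebra of `G` as endomorphisms of the model space. -/
noncomputable def endGroupLieAlgebraEquiv :
    (GroupLieAlgebra 𝓘(ℝ, E) G →L[ℝ] GroupLieAlgebra 𝓘(ℝ, E) G) ≃L[ℝ] (E →L[ℝ] E) :=
  ContinuousLinearEquiv.arrowCongr (groupLieAlgebraEquiv E G) (groupLieAlgebraEquiv E G)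

variable [LieGroup 𝓘(ℝ, E) ∞ G]

theorem Ad_eq_symm_fderiv_chartConj (g : G) :
    Ad E G g = (endGroupLieAlgebraEquiv E G).symm
      (fderiv ℝ (chartConj E g) (extChartAt 𝓘(ℝ, E) (1 : G) 1)) := by
  ext1 Y
  exact Ad_eq_fderiv_chartConj (E := E) g (show E from Y)

/-- The derivative of the conjugation by the point with coordinates `x`. -/
theorem contDiffAt_fderiv_chartConj : ContDiffAt ℝ ∞
    (fun x : E => fderiv ℝ (chartConj E ((extChartAt 𝓘(ℝ, E) (1 : G)).symm x))
      (extChartAt 𝓘(ℝ, E) (1 : G) 1)) (extChartAt 𝓘(ℝ, E) (1 : G) 1) :=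
  ContDiffAt.fderiv contDiffAt_chartConj contDiffAt_const (by simp)

/-- Near `1`, `Ad` is a partial derivative of the smooth conjugation map in the chart. The identity
`Ad x = Ad g ∘ Ad (g⁻¹ x)` carries smoothness to every `g`. -/
theorem contMDiff_Ad : ContMDiff 𝓘(ℝ, E)
    𝓘(ℝ, GroupLieAlgebra 𝓘(ℝ, E) G →L[ℝ] GroupLieAlgebra 𝓘(ℝ, E) G) ∞ (Ad E G) := by
  have h1 : ContMDiffAt 𝓘(ℝ, E)
      𝓘(ℝ, GroupLieAlgebra 𝓘(ℝ, E) G →L[ℝ] GroupLieAlgebra 𝓘(ℝ, E) G) ∞ (Ad E G) 1 := by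
    have h2 := contDiffAt_fderiv_chartConj (E := E) (G := G)
    have h3 : ContMDiffAt 𝓘(ℝ, E) 𝓘(ℝ, E →L[ℝ] E) ∞
        (fun g : G => fderiv ℝ (chartConj E ((extChartAt 𝓘(ℝ, E) (1 : G)).symm
          (extChartAt 𝓘(ℝ, E) (1 : G) g))) (extChartAt 𝓘(ℝ, E) (1 : G) 1)) 1 :=
      ContMDiffAt.comp (I' := 𝓘(ℝ, E)) (1 : G) h2.contMDiffAt (contMDiffAt_chartOne rfl)
    have h4 := (endGroupLieAlgebraEquiv E G).symm.contDiff (n := ∞) |>.contMDiff.contMDiffAt.comp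
      (1 : G) h3
    refine h4.congr_of_eventuallyEq ?_
    filter_upwards [extChartAt_source_mem_nhds (I := 𝓘(ℝ, E)) (1 : G)] with g hg
    rw [Ad_eq_symm_fderiv_chartConj, Function.comp_apply,
      (extChartAt 𝓘(ℝ, E) (1 : G)).left_inv hg]
  intro g
  have h2 : ContMDiffAt 𝓘(ℝ, E)
      𝓘(ℝ, GroupLieAlgebra 𝓘(ℝ, E) G →L[ℝ] GroupLieAlgebra 𝓘(ℝ, E) G) ∞
      (fun x => Ad E G (g⁻¹ * x)) g := by
    refine ContMDiffAt.comp (I' := 𝓘(ℝ, E)) g ?_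
      (contMDiff_mul_left (I := 𝓘(ℝ, E)) (n := ∞) (a := g⁻¹)).contMDiffAt
    rwa [inv_mul_cancel]
  have h3 := (((ContinuousLinearMap.compL ℝ (GroupLieAlgebra 𝓘(ℝ, E) G)
    (GroupLieAlgebra 𝓘(ℝ, E) G) (GroupLieAlgebra 𝓘(ℝ, E) G)) (Ad E G g)).contDiff
      (n := ∞)).contMDiff.contMDiffAt.comp g h2
  refine h3.congr_of_eventuallyEq (Eventually.of_forall fun x => ?_)
  have h4 : Ad E G x = Ad E G g * Ad E G (g⁻¹ * x) := by rw [← map_mul, mul_inv_cancel_left]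
  exact h4

/-- Left translation is right translation after a conjugation, in the chart at `1`. -/
theorem eventually_fderiv_chartMul_eq :
    ∀ᶠ x in 𝓝 (extChartAt 𝓘(ℝ, E) (1 : G) 1), ∀ Y : E,
      fderiv ℝ (chartMul E G) (x, extChartAt 𝓘(ℝ, E) (1 : G) 1) (0, Y) =
        fderiv ℝ (chartMul E G) (extChartAt 𝓘(ℝ, E) (1 : G) 1, x)
          (fderiv ℝ (chartConj E ((extChartAt 𝓘(ℝ, E) (1 : G)).symm x))
            (extChartAt 𝓘(ℝ, E) (1 : G) 1) Y, 0) := by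
  set φ := extChartAt 𝓘(ℝ, E) (1 : G) with hφ
  have hφ1 : φ.symm (φ 1) = 1 := chartOne_symm
  have hmd : ∀ᶠ p in 𝓝 (φ 1, φ 1), DifferentiableAt ℝ (chartMul E G) p :=
    ((contDiffAt_chartMul (E := E) (G := G)).of_le (m := 1) (by simp)).eventually (by simp)
      |>.mono fun p hp => hp.differentiableAt (by simp)
  have hcd : ∀ᶠ p in 𝓝 (φ 1, φ 1), DifferentiableAt ℝ
      (Function.uncurry fun x : E => chartConj E (φ.symm x)) p :=
    ((contDiffAt_chartConj (E := E) (G := G)).of_le (m := 1) (by simp)).eventually (by simp)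
      |>.mono fun p hp => hp.differentiableAt (by simp)
  have hl : Tendsto (fun x : E => (x, φ 1)) (𝓝 (φ 1)) (𝓝 (φ 1, φ 1)) :=
    (continuous_id.prodMk continuous_const).tendsto _
  have hr : Tendsto (fun x : E => (φ 1, x)) (𝓝 (φ 1)) (𝓝 (φ 1, φ 1)) :=
    (continuous_const.prodMk continuous_id).tendsto _
  filter_upwards [hl.eventually hmd, hr.eventually hmd, hl.eventually hcd,
    extChartAt_target_mem_nhds (I := 𝓘(ℝ, E)) (1 : G)] with x h1 h2 h3 hx Y
  set g := φ.symm x with hg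
  have hC1 : chartConj E g (φ 1) = φ 1 := by
    simp only [chartConj, ← hφ, hφ1, mul_one, mul_inv_cancel]
  have hC : DifferentiableAt ℝ (chartConj E g) (φ 1) :=
    h3.comp (φ 1) (hasFDerivAt_prodMk_right x (φ 1)).differentiableAt
  have e1 : fderiv ℝ (chartMul E G) (x, φ 1) (0, Y) =
      fderiv ℝ (fun y => chartMul E G (x, y)) (φ 1) Y := by
    have := (h1.hasFDerivAt.comp (f := fun y : E => (x, y)) (φ 1)
      (hasFDerivAt_prodMk_right x (φ 1))).fderiv
    exact (ContinuousLinearMap.ext_iff.1 this Y).symm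
  have h2' : HasFDerivAt (fun y => chartMul E G (y, x))
      ((fderiv ℝ (chartMul E G) (φ 1, x)).comp (ContinuousLinearMap.inl ℝ E E)) (φ 1) :=
    h2.hasFDerivAt.comp (f := fun y : E => (y, x)) (φ 1) (hasFDerivAt_prodMk_left (φ 1) x)
  rw [← hC1] at h2'
  have e2 := h2'.comp (φ 1) hC.hasFDerivAt
  rw [hC1] at e2
  -- This is `g y = (g y g⁻¹) g`. It holds in coordinates only while `g y g⁻¹` stays in the chart
  -- domain.
  have e3 : (fun y => chartMul E G (x, y)) =ᶠ[𝓝 (φ 1)]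
      (fun y => chartMul E G (y, x)) ∘ chartConj E g := by
    have hc : ContinuousAt (fun y => g * φ.symm y * g⁻¹) (φ 1) :=
      (contMDiff_conj (E := E) g).continuous.continuousAt.comp
        (contMDiffAt_chartOne_symm (E := E) (G := G)).continuousAt
    have hs : φ.source ∈ 𝓝 (g * φ.symm (φ 1) * g⁻¹) := by
      rw [hφ1, mul_one, mul_inv_cancel]
      exact extChartAt_source_mem_nhds (I := 𝓘(ℝ, E)) (1 : G)
    filter_upwards [hc.eventually hs] with y hy
    have := φ.left_inv hy
    simp only [Function.comp_apply, chartMul, chartConj, ← hφ, this, ← hg]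
    rw [inv_mul_cancel_right]
  rw [e1, e3.fderiv_eq, e2.fderiv]
  rfl

/-- The chart at `1` has the identity as derivative at `1`, so the inverse derivative in the
definition of the bracket drops out. The fields enter through a variable `W`, which keeps their
expressions folded. -/
theorem bracket_eq_lieBracketWithin (ξ Y : GroupLieAlgebra 𝓘(ℝ, E) G) (W : Bool → E → E)
    (hξ : W true = VectorField.mpullbackWithin 𝓘(ℝ, E) 𝓘(ℝ, E) (extChartAt 𝓘(ℝ, E) (1 : G)).symm
        (mulInvariantVectorField ξ) (Set.range 𝓘(ℝ, E)))
    (hY : W false = VectorField.mpullbackWithin 𝓘(ℝ, E) 𝓘(ℝ, E) (extChartAt 𝓘(ℝ, E) (1 : G)).symm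
        (mulInvariantVectorField Y) (Set.range 𝓘(ℝ, E))) :
    groupLieAlgebraEquiv E G ⁅ξ, Y⁆ =
      VectorField.lieBracketWithin ℝ (W true) (W false)
        ((extChartAt 𝓘(ℝ, E) (1 : G)).symm ⁻¹' Set.univ ∩ Set.range 𝓘(ℝ, E))
        (extChartAt 𝓘(ℝ, E) (1 : G) 1) := by
  have hi : ∀ L : E →L[ℝ] E, L = ContinuousLinearMap.id ℝ E → ∀ w, L.inverse w = w := by
    rintro _ rfl w
    rw [ContinuousLinearMap.inverse_id]
    rfl
  rw [hξ, hY]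
  exact hi (mfderiv 𝓘(ℝ, E) 𝓘(ℝ, E) (extChartAt 𝓘(ℝ, E) (1 : G)) 1) mfderiv_extChartAt_self _

/-- Near the centre of the chart, left invariant fields are partial derivatives of the
multiplication, and a Lie bracket depends only on germs. -/
theorem bracket_eq_lieBracket_chartOne (ξ Y : GroupLieAlgebra 𝓘(ℝ, E) G) :
    groupLieAlgebraEquiv E G ⁅ξ, Y⁆ = VectorField.lieBracket ℝ
      (fun x => fderiv ℝ (chartMul E G) (x, extChartAt 𝓘(ℝ, E) (1 : G) 1)
        (0, groupLieAlgebraEquiv E G ξ))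
      (fun x => fderiv ℝ (chartMul E G) (x, extChartAt 𝓘(ℝ, E) (1 : G) 1)
        (0, groupLieAlgebraEquiv E G Y))
      (extChartAt 𝓘(ℝ, E) (1 : G) 1) := by
  have hmd : ∀ᶠ p in 𝓝 (extChartAt 𝓘(ℝ, E) (1 : G) 1, extChartAt 𝓘(ℝ, E) (1 : G) 1),
      DifferentiableAt ℝ (chartMul E G) p :=
    ((contDiffAt_chartMul (E := E) (G := G)).of_le (m := 1) (by simp)).eventually (by simp)
      |>.mono fun p hp => hp.differentiableAt (by simp)
  have hl : Tendsto (fun x : E => (x, extChartAt 𝓘(ℝ, E) (1 : G) 1))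
      (𝓝 (extChartAt 𝓘(ℝ, E) (1 : G) 1)) (𝓝 (_, extChartAt 𝓘(ℝ, E) (1 : G) 1)) :=
    (continuous_id.prodMk continuous_const).tendsto _
  obtain ⟨W, hW⟩ : ∃ W : GroupLieAlgebra 𝓘(ℝ, E) G → E → E, ∀ v, W v =
      VectorField.mpullbackWithin 𝓘(ℝ, E) 𝓘(ℝ, E) (extChartAt 𝓘(ℝ, E) (1 : G)).symm
        (mulInvariantVectorField v) (Set.range 𝓘(ℝ, E)) := ⟨_, fun _ => rfl⟩
  have hV : ∀ v : GroupLieAlgebra 𝓘(ℝ, E) G, W v =ᶠ[𝓝 (extChartAt 𝓘(ℝ, E) (1 : G) 1)]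
      fun x => fderiv ℝ (chartMul E G) (x, extChartAt 𝓘(ℝ, E) (1 : G) 1)
        (0, groupLieAlgebraEquiv E G v) := by
    intro v
    filter_upwards [hl.eventually hmd,
      extChartAt_target_mem_nhds (I := 𝓘(ℝ, E)) (1 : G)] with x h1 hx
    rw [hW]
    exact mpullback_mulInvariantVectorField_chartOne v hx h1
  have hs : (extChartAt 𝓘(ℝ, E) (1 : G)).symm ⁻¹' Set.univ ∩ Set.range 𝓘(ℝ, E) = Set.univ := by
    simp
  rw [bracket_eq_lieBracketWithin ξ Y (fun b => if b then W ξ else W Y) (hW ξ) (hW Y), hs,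
    VectorField.lieBracketWithin_univ]
  exact (hV ξ).lieBracket_vectorField_eq (hV Y)

/-- The derivative of `Ad` at the identity is `ad`. -/
theorem mfderiv_Ad_one (ξ Y : GroupLieAlgebra 𝓘(ℝ, E) G) :
    (show GroupLieAlgebra 𝓘(ℝ, E) G →L[ℝ] GroupLieAlgebra 𝓘(ℝ, E) G from
      mfderiv 𝓘(ℝ, E) 𝓘(ℝ, GroupLieAlgebra 𝓘(ℝ, E) G →L[ℝ] GroupLieAlgebra 𝓘(ℝ, E) G)
        (Ad E G) 1 ξ) Y = ⁅ξ, Y⁆ := by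
  set φ := extChartAt 𝓘(ℝ, E) (1 : G) with hφ
  have hφ1 : φ.symm (φ 1) = 1 := chartOne_symm
  let A : E → E →L[ℝ] E := fun x => fderiv ℝ (chartConj E (φ.symm x)) (φ 1)
  have hA : DifferentiableAt ℝ A (φ 1) :=
    (contDiffAt_fderiv_chartConj (E := E) (G := G)).differentiableAt (by simp)
  have hA1 : A (φ 1) = ContinuousLinearMap.id ℝ E := by
    ext Y
    have h1 := Ad_eq_fderiv_chartConj (E := E) (1 : G) Y
    rw [map_one] at h1
    change fderiv ℝ (chartConj E (φ.symm (φ 1))) (φ 1) Y = Y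
    rw [hφ1]
    exact h1.symm
  have hr : ∀ᶠ x in 𝓝 (φ 1), chartMul E G (x, φ 1) = x := by
    filter_upwards [extChartAt_target_mem_nhds (I := 𝓘(ℝ, E)) (1 : G)] with x hx
    simp only [chartMul, ← hφ, hφ1, mul_one]
    exact φ.right_inv hx
  have h2 : ContDiffAt ℝ 2 (chartMul E G) (φ 1, φ 1) :=
    contDiffAt_chartMul.of_le ENat.LEInfty.out
  have key := fderiv_conj_eq_lieBracket h2 hr hA hA1 eventually_fderiv_chartMul_eq
    (groupLieAlgebraEquiv E G ξ) (groupLieAlgebraEquiv E G Y)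
  have h0 : MDifferentiableAt 𝓘(ℝ, E)
      𝓘(ℝ, GroupLieAlgebra 𝓘(ℝ, E) G →L[ℝ] GroupLieAlgebra 𝓘(ℝ, E) G) (Ad E G) 1 :=
    ContMDiffAt.mdifferentiableAt (n := ∞) contMDiff_Ad.contMDiffAt (by simp)
  have h1 : mfderiv 𝓘(ℝ, E) 𝓘(ℝ, GroupLieAlgebra 𝓘(ℝ, E) G →L[ℝ] GroupLieAlgebra 𝓘(ℝ, E) G)
        (Ad E G) 1 ξ = fderiv ℝ (fun x => Ad E G (φ.symm x)) (φ 1) (groupLieAlgebraEquiv E G ξ) :=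
    ContinuousLinearMap.ext_iff.1 h0.mfderiv_eq_fderiv_chart ξ
  have h2 : (fun x => Ad E G (φ.symm x)) = fun x => (endGroupLieAlgebraEquiv E G).symm (A x) :=
    funext fun x => Ad_eq_symm_fderiv_chartConj _
  have h3 : fderiv ℝ (fun x => Ad E G (φ.symm x)) (φ 1) (groupLieAlgebraEquiv E G ξ) =
      (endGroupLieAlgebraEquiv E G).symm (fderiv ℝ A (φ 1) (groupLieAlgebraEquiv E G ξ)) := by
    rw [h2]
    exact ContinuousLinearMap.ext_iff.1 ((endGroupLieAlgebraEquiv E G).symm.hasFDerivAt.comp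
      (φ 1) hA.hasFDerivAt).fderiv _
  have h4 := ContinuousLinearMap.ext_iff.1 (h1.trans h3) Y
  refine h4.trans ((groupLieAlgebraEquiv E G).injective ?_)
  exact key.trans (bracket_eq_lieBracket_chartOne ξ Y).symm

end AdSmooth

/-! ### Invariance of the Killing form and the coadjoint fields -/

section AdjointAlgebra

open Filter Topology

variable {E : Type*} [NormedAddCommGroup E] [NormedSpace ℝ E] [FiniteDimensional ℝ E]
  [CompleteSpace E]
  {G : Type*} [TopologicalSpace G] [ChartedSpace E G] [Group G] [LieGroup 𝓘(ℝ, E) ∞ G]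

/-- `ad ξ` as a continuous linear map. -/
noncomputable def adCLM (ξ : GroupLieAlgebra 𝓘(ℝ, E) G) :
    GroupLieAlgebra 𝓘(ℝ, E) G →L[ℝ] GroupLieAlgebra 𝓘(ℝ, E) G :=
  LinearMap.toContinuousLinearMap (LieAlgebra.ad ℝ (GroupLieAlgebra 𝓘(ℝ, E) G) ξ)

theorem adCLM_apply (ξ Y : GroupLieAlgebra 𝓘(ℝ, E) G) : adCLM ξ Y = ⁅ξ, Y⁆ := rfl

theorem adCLM_lie (ξ η : GroupLieAlgebra 𝓘(ℝ, E) G) :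
    adCLM ⁅ξ, η⁆ = adCLM ξ * adCLM η - adCLM η * adCLM ξ := by
  ext Y
  simp [adCLM_apply]

theorem mfderiv_Ad_one_eq_adCLM (ξ : GroupLieAlgebra 𝓘(ℝ, E) G) :
    mfderiv 𝓘(ℝ, E) 𝓘(ℝ, GroupLieAlgebra 𝓘(ℝ, E) G →L[ℝ] GroupLieAlgebra 𝓘(ℝ, E) G)
      (Ad E G) 1 ξ = adCLM ξ :=
  ContinuousLinearMap.ext fun Y => mfderiv_Ad_one ξ Y

theorem mdifferentiableAt_Ad (g : G) : MDifferentiableAt 𝓘(ℝ, E)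
    𝓘(ℝ, GroupLieAlgebra 𝓘(ℝ, E) G →L[ℝ] GroupLieAlgebra 𝓘(ℝ, E) G) (Ad E G) g :=
  ContMDiffAt.mdifferentiableAt (n := ∞) contMDiff_Ad.contMDiffAt (by simp)

/-- The chain rule for `Ad ∘ k` at a point where `k` takes the value `1`. -/
theorem mfderiv_Ad_comp {F : Type*} [NormedAddCommGroup F] [NormedSpace ℝ F]
    {M : Type*} [TopologicalSpace M] [ChartedSpace F M] {k : M → G} {y : M}
    (hk : MDifferentiableAt 𝓘(ℝ, F) 𝓘(ℝ, E) k y) (hy : k y = 1) (b : TangentSpace 𝓘(ℝ, F) y) :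
    mfderiv 𝓘(ℝ, F) 𝓘(ℝ, GroupLieAlgebra 𝓘(ℝ, E) G →L[ℝ] GroupLieAlgebra 𝓘(ℝ, E) G)
      (fun x => Ad E G (k x)) y b =
      adCLM (show GroupLieAlgebra 𝓘(ℝ, E) G from mfderiv 𝓘(ℝ, F) 𝓘(ℝ, E) k y b) := by
  have h1 := mfderiv_comp_of_eq (mdifferentiableAt_Ad (E := E) (1 : G)) hk hy
  have h2 : ∀ g : G, g = 1 → ∀ ξ : E,
      (mfderiv 𝓘(ℝ, E) 𝓘(ℝ, GroupLieAlgebra 𝓘(ℝ, E) G →L[ℝ] GroupLieAlgebra 𝓘(ℝ, E) G)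
        (Ad E G) g ξ : GroupLieAlgebra 𝓘(ℝ, E) G →L[ℝ] GroupLieAlgebra 𝓘(ℝ, E) G) =
      adCLM (show GroupLieAlgebra 𝓘(ℝ, E) G from ξ) := by
    rintro _ rfl ξ
    exact mfderiv_Ad_one_eq_adCLM _
  exact (ContinuousLinearMap.ext_iff.1 h1 b).trans (h2 _ hy _)

theorem Ad_inv_mul (g : G) : Ad E G g⁻¹ * Ad E G g = 1 := by
  rw [← map_mul, inv_mul_cancel, map_one]

theorem Ad_mul_inv (g : G) : Ad E G g * Ad E G g⁻¹ = 1 := by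
  rw [← map_mul, mul_inv_cancel, map_one]

/-- Differentiate `Ad (g x g⁻¹) = Ad g ∘ Ad x ∘ Ad g⁻¹` at `x = 1`. Evaluating the result at `Ad g
η` shows that `Ad g` respects brackets. -/
theorem adCLM_Ad (g : G) (ξ : GroupLieAlgebra 𝓘(ℝ, E) G) :
    adCLM (Ad E G g ξ) = Ad E G g * adCLM ξ * Ad E G g⁻¹ := by
  have hk : MDifferentiableAt 𝓘(ℝ, E) 𝓘(ℝ, E) (fun x : G => g * x * g⁻¹) 1 :=
    (contMDiff_conj g).contMDiffAt.mdifferentiableAt (by simp)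
  have h1 := mfderiv_Ad_comp hk (by simp) ξ
  let L : (GroupLieAlgebra 𝓘(ℝ, E) G →L[ℝ] GroupLieAlgebra 𝓘(ℝ, E) G) →L[ℝ]
    (GroupLieAlgebra 𝓘(ℝ, E) G →L[ℝ] GroupLieAlgebra 𝓘(ℝ, E) G) :=
    ContinuousLinearMap.mulLeftRight ℝ _ (Ad E G g) (Ad E G g⁻¹)
  have h2 : (fun x => Ad E G (g * x * g⁻¹)) = L ∘ Ad E G := by
    ext1 x
    simp [L]
  have h3 := (L.hasMFDerivAt.comp (1 : G)
    (mdifferentiableAt_Ad (E := E) (1 : G)).hasMFDerivAt).mfderiv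
  rw [h2] at h1
  have h4 := (ContinuousLinearMap.ext_iff.1 h3 ξ).symm.trans h1
  refine h4.symm.trans ?_
  change L (mfderiv 𝓘(ℝ, E) 𝓘(ℝ, GroupLieAlgebra 𝓘(ℝ, E) G →L[ℝ] GroupLieAlgebra 𝓘(ℝ, E) G)
      (Ad E G) 1 ξ) = _
  rw [mfderiv_Ad_one_eq_adCLM]
  simp [L]

theorem Ad_lie (g : G) (ξ η : GroupLieAlgebra 𝓘(ℝ, E) G) :
    Ad E G g ⁅ξ, η⁆ = ⁅Ad E G g ξ, Ad E G g η⁆ := by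
  have h := ContinuousLinearMap.ext_iff.1 (adCLM_Ad g ξ) (Ad E G g η)
  have h2 : Ad E G g⁻¹ (Ad E G g η) = η := ContinuousLinearMap.ext_iff.1 (Ad_inv_mul g) η
  refine Eq.symm (h.trans ?_)
  change Ad E G g (adCLM ξ (Ad E G g⁻¹ (Ad E G g η))) = _
  rw [h2]
  rfl

theorem killingForm_Ad (g : G) (X Y : GroupLieAlgebra 𝓘(ℝ, E) G) :
    killingForm ℝ (GroupLieAlgebra 𝓘(ℝ, E) G) (Ad E G g X) (Ad E G g Y) =
      killingForm ℝ (GroupLieAlgebra 𝓘(ℝ, E) G) X Y := by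
  let e : GroupLieAlgebra 𝓘(ℝ, E) G ≃ₗ⁅ℝ⁆ GroupLieAlgebra 𝓘(ℝ, E) G :=
    { (Ad E G g).toLinearMap with
      map_lie' := fun {ξ η} => Ad_lie g ξ η
      invFun := Ad E G g⁻¹
      left_inv := ContinuousLinearMap.ext_iff.1 (Ad_inv_mul g)
      right_inv := ContinuousLinearMap.ext_iff.1 (Ad_mul_inv g) }
  exact LieAlgebra.killingForm_of_equiv_apply e X Y

theorem killingFlat_apply (X Y : GroupLieAlgebra 𝓘(ℝ, E) G) :
    killingFlat E G X Y = killingForm ℝ (GroupLieAlgebra 𝓘(ℝ, E) G) X Y := rfl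

theorem coAd_apply (g : G) (α : StrongDual ℝ (GroupLieAlgebra 𝓘(ℝ, E) G))
    (Y : GroupLieAlgebra 𝓘(ℝ, E) G) : coAd E G g α Y = α (Ad E G g⁻¹ Y) := rfl

theorem killingFlat_Ad (g : G) (X : GroupLieAlgebra 𝓘(ℝ, E) G) :
    killingFlat E G (Ad E G g X) = coAd E G g (killingFlat E G X) := by
  ext Y
  have h2 : Ad E G g (Ad E G g⁻¹ Y) = Y := ContinuousLinearMap.ext_iff.1 (Ad_mul_inv g) Y
  rw [coAd_apply, killingFlat_apply, killingFlat_apply, ← killingForm_Ad g X, h2]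

theorem killingFlat_bijective
    (hG : (killingForm ℝ (GroupLieAlgebra 𝓘(ℝ, E) G)).Nondegenerate) :
    Function.Bijective (killingFlat E G) := by
  have hinj : Function.Injective (killingFlat E G) := by
    rw [← LinearMap.ker_eq_bot, LinearMap.ker_eq_bot']
    intro X hX
    exact hG.1 X fun Y => ContinuousLinearMap.ext_iff.1 hX Y
  refine ⟨hinj, ?_⟩
  rw [← LinearMap.injective_iff_surjective_of_finrank_eq_finrank]
  · exact hinj
  · rw [← (LinearMap.toContinuousLinearMap (𝕜 := ℝ) (E := GroupLieAlgebra 𝓘(ℝ, E) G)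
      (F' := ℝ)).finrank_eq]
    exact (Subspace.dual_finrank_eq (K := ℝ) (V := GroupLieAlgebra 𝓘(ℝ, E) G)).symm

theorem contMDiff_Ad_inv : ContMDiff 𝓘(ℝ, E)
    𝓘(ℝ, GroupLieAlgebra 𝓘(ℝ, E) G →L[ℝ] GroupLieAlgebra 𝓘(ℝ, E) G) ∞
    (fun g : G => Ad E G g⁻¹) :=
  contMDiff_Ad.comp (contMDiff_inv 𝓘(ℝ, E) ∞)

theorem contMDiff_coAd : ContMDiff 𝓘(ℝ, E)
    𝓘(ℝ, StrongDual ℝ (GroupLieAlgebra 𝓘(ℝ, E) G) →L[ℝ]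
      StrongDual ℝ (GroupLieAlgebra 𝓘(ℝ, E) G)) ∞ (coAd E G) := by
  have h : ContDiff ℝ ∞ (ContinuousLinearMap.compL ℝ (GroupLieAlgebra 𝓘(ℝ, E) G)
    (GroupLieAlgebra 𝓘(ℝ, E) G) ℝ).flip := ContinuousLinearMap.contDiff _
  exact h.contMDiff.comp contMDiff_Ad_inv

/-- The derivative of `y ↦ Ad (g y)` along a map `g` from a vector space into the group. -/
theorem exists_fderiv_Ad_comp {F : Type*} [NormedAddCommGroup F] [NormedSpace ℝ F] {g : F → G}
    {y : F} (hg : MDifferentiableAt 𝓘(ℝ, F) 𝓘(ℝ, E) g y) (b : F) :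
    ∃ ξ : GroupLieAlgebra 𝓘(ℝ, E) G,
      fderiv ℝ (fun x => Ad E G (g x)) y b = adCLM ξ * Ad E G (g y) := by
  have hk : MDifferentiableAt 𝓘(ℝ, F) 𝓘(ℝ, E) (fun x => g x * (g y)⁻¹) y :=
    MDifferentiableAt.comp (I' := 𝓘(ℝ, E)) y
      ((contMDiff_mul_right (I := 𝓘(ℝ, E)) (n := ∞) (a := (g y)⁻¹)).contMDiffAt.mdifferentiableAt
        (by simp)) hg
  -- Right translation moves the value at `y` to `1`, so `ξ` is the derivative `dg(b) g⁻¹`.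
  refine ⟨mfderiv 𝓘(ℝ, F) 𝓘(ℝ, E) (fun x => g x * (g y)⁻¹) y b, ?_⟩
  have h1 := mfderiv_Ad_comp hk (by simp) b
  rw [mfderiv_eq_fderiv] at h1
  have h2 : (fun x => Ad E G (g x)) = fun x => Ad E G (g x * (g y)⁻¹) * Ad E G (g y) := by
    ext1 x
    rw [← map_mul, inv_mul_cancel_right]
  have hd : DifferentiableAt ℝ (fun x => Ad E G (g x * (g y)⁻¹)) y := by
    rw [← mdifferentiableAt_iff_differentiableAt]
    exact MDifferentiableAt.comp (I' := 𝓘(ℝ, E)) y (mdifferentiableAt_Ad _) hk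
  let R := (ContinuousLinearMap.mul ℝ
    (GroupLieAlgebra 𝓘(ℝ, E) G →L[ℝ] GroupLieAlgebra 𝓘(ℝ, E) G)).flip (Ad E G (g y))
  have h3 := (R.hasFDerivAt.comp y hd.hasFDerivAt).fderiv
  rw [h2]
  refine (ContinuousLinearMap.ext_iff.1 h3 b).trans ?_
  exact congrArg (· * Ad E G (g y)) h1

/-- The product rule for `Ad g ∘ Ad g⁻¹ = 1` gives `-ad ξ` as the derivative of `g ↦ Ad g⁻¹` at `1`.
-/
theorem fundamentalField_coAd_apply (ξ Y : GroupLieAlgebra 𝓘(ℝ, E) G)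
    (ν : StrongDual ℝ (GroupLieAlgebra 𝓘(ℝ, E) G)) :
    fundamentalField (coAd E G) ξ ν Y = -(ν ⁅ξ, Y⁆) := by
  have h1 := (mdifferentiableAt_Ad (E := E) (1 : G)).hasMFDerivAt
  have h2 : MDifferentiableAt 𝓘(ℝ, E)
      𝓘(ℝ, GroupLieAlgebra 𝓘(ℝ, E) G →L[ℝ] GroupLieAlgebra 𝓘(ℝ, E) G)
      (fun g : G => Ad E G g⁻¹) 1 :=
    ContMDiffAt.mdifferentiableAt (n := ∞) contMDiff_Ad_inv.contMDiffAt (by simp)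
  have h3 := h1.mul' h2.hasMFDerivAt
  have h4 : (Ad E G : G → _) * (fun g : G => Ad E G g⁻¹) = fun _ => 1 :=
    funext fun g => Ad_mul_inv g
  rw [h4] at h3
  have h5 := ContinuousLinearMap.ext_iff.1 (hasMFDerivAt_unique h3 (hasMFDerivAt_const _ _)) ξ
  have h6 : Ad E G 1 * (show GroupLieAlgebra 𝓘(ℝ, E) G →L[ℝ] GroupLieAlgebra 𝓘(ℝ, E) G from
      mfderiv 𝓘(ℝ, E) 𝓘(ℝ, GroupLieAlgebra 𝓘(ℝ, E) G →L[ℝ] GroupLieAlgebra 𝓘(ℝ, E) G)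
        (fun g : G => Ad E G g⁻¹) 1 ξ) +
      (show GroupLieAlgebra 𝓘(ℝ, E) G →L[ℝ] GroupLieAlgebra 𝓘(ℝ, E) G from
      mfderiv 𝓘(ℝ, E) 𝓘(ℝ, GroupLieAlgebra 𝓘(ℝ, E) G →L[ℝ] GroupLieAlgebra 𝓘(ℝ, E) G)
        (Ad E G) 1 ξ) * Ad E G (1 : G)⁻¹ = 0 := h5
  rw [mfderiv_Ad_one_eq_adCLM, inv_one, map_one, one_mul, mul_one] at h6
  have h7 := eq_neg_of_add_eq_zero_left h6
  let L := ContinuousLinearMap.compL ℝ (GroupLieAlgebra 𝓘(ℝ, E) G) (GroupLieAlgebra 𝓘(ℝ, E) G)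
    ℝ ν
  have h8 := (L.hasMFDerivAt.comp (1 : G) h2.hasMFDerivAt).mfderiv
  have h9 : fundamentalField (coAd E G) ξ ν = L (-adCLM ξ) :=
    (ContinuousLinearMap.ext_iff.1 h8 ξ).trans (congrArg L h7)
  rw [h9]
  simp [L, adCLM_apply]

end AdjointAlgebra

/-! ### Local exactness of the KKS form -/

section KKSForms

open Filter Topology

variable {E : Type*} [NormedAddCommGroup E] [NormedSpace ℝ E] [FiniteDimensional ℝ E]
  [CompleteSpace E]
  {G : Type*} [TopologicalSpace G] [ChartedSpace E G] [Group G] [LieGroup 𝓘(ℝ, E) ∞ G]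

/-- The linear form `T ↦ tr (ad X ∘ T)`. -/
noncomputable def traceAd (X : GroupLieAlgebra 𝓘(ℝ, E) G) :
    (GroupLieAlgebra 𝓘(ℝ, E) G →L[ℝ] GroupLieAlgebra 𝓘(ℝ, E) G) →L[ℝ] ℝ :=
  LinearMap.toContinuousLinearMap (LinearMap.trace ℝ (GroupLieAlgebra 𝓘(ℝ, E) G) ∘ₗ
    ContinuousLinearMap.coeLM ℝ ∘ₗ LinearMap.mulLeft ℝ (adCLM X))

/-- This extends `B♭ X` from `𝔤` to all endomorphisms, so that it applies to products of derivatives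
of `Ad`. -/
theorem killingFlat_eq_traceAd (X Z : GroupLieAlgebra 𝓘(ℝ, E) G) :
    killingFlat E G X Z = traceAd X (adCLM Z) :=
  killingForm_apply_apply ℝ _ X Z

variable {F : Type*} [NormedAddCommGroup F] [NormedSpace ℝ F]

theorem extDeriv_ofSubsingleton_apply {h : F → F →L[ℝ] ℝ} {y : F} (hh : DifferentiableAt ℝ h y)
    (b c : F) : extDeriv (fun x => ContinuousAlternatingMap.ofSubsingletonLIE (𝕜 := ℝ) (E := F)
      (F := ℝ) (0 : Fin 1) (h x)) y ![b, c] = fderiv ℝ (fun x => h x c) y b - fderiv ℝ (fun x => h x b) y c := by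
  rw [extDeriv_apply]
  · rw [Fin.sum_univ_two]
    simp [Fin.removeNth, sub_eq_add_neg]
  · exact ((ContinuousAlternatingMap.ofSubsingletonLIE (𝕜 := ℝ) (E := F) (F := ℝ)
      (0 : Fin 1)).toContinuousLinearEquiv.differentiableAt).comp y hh

theorem ContDiffAt.eventually_differentiableAt_infty {Z : Type*} [NormedAddCommGroup Z]
    [NormedSpace ℝ Z] {k : F → Z} {y : F} (hk : ContDiffAt ℝ ∞ k y) :
    ∀ᶠ x in 𝓝 y, DifferentiableAt ℝ k x :=
  ((hk.of_le (m := 1) (by simp)).eventually (by simp)).mono fun x hx =>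
    hx.differentiableAt (by simp)

theorem ContMDiffAt.eventually_mdifferentiableAt {g : F → G} {y : F}
    (hg : ContMDiffAt 𝓘(ℝ, F) 𝓘(ℝ, E) ∞ g y) :
    ∀ᶠ x in 𝓝 y, MDifferentiableAt 𝓘(ℝ, F) 𝓘(ℝ, E) g x := by
  have h1 : IsManifold 𝓘(ℝ, E) 1 G := IsManifold.of_le (n := ∞) (by simp)
  have h2 : ContMDiffAt 𝓘(ℝ, F) 𝓘(ℝ, E) 1 g y := hg.of_le (by simp)
  exact ((contMDiffAt_iff_contMDiffAt_nhds (by simp)).1 h2).mono fun x hx =>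
    hx.mdifferentiableAt (by simp)

/-- A two-form given by the Kirillov-Kostant-Souriau formula along a smooth map into a coadjoint
orbit is smooth and closed. -/
theorem contDiffAt_and_extDeriv_eq_zero_of_kks {X : GroupLieAlgebra 𝓘(ℝ, E) G} {g : F → G} {y₀ : F}
    (hg : ContMDiffAt 𝓘(ℝ, F) 𝓘(ℝ, E) ∞ g y₀)
    {ν : F → StrongDual ℝ (GroupLieAlgebra 𝓘(ℝ, E) G)}
    (hν : ν =ᶠ[𝓝 y₀] fun y => coAd E G (g y) (killingFlat E G X))
    {τ : F → F [⋀^Fin 2]→L[ℝ] ℝ}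
    (hτ : ∀ᶠ y in 𝓝 y₀, ∀ (b c : F) (ξ η : GroupLieAlgebra 𝓘(ℝ, E) G),
      fderiv ℝ ν y b = fundamentalField (coAd E G) ξ (ν y) →
      fderiv ℝ ν y c = fundamentalField (coAd E G) η (ν y) → τ y ![b, c] = -(ν y ⁅ξ, η⁆)) :
    ContDiffAt ℝ ∞ τ y₀ ∧ extDeriv τ y₀ = 0 := by
  let a : F → GroupLieAlgebra 𝓘(ℝ, E) G →L[ℝ] GroupLieAlgebra 𝓘(ℝ, E) G := fun y => Ad E G (g y)
  let ai : F → GroupLieAlgebra 𝓘(ℝ, E) G →L[ℝ] GroupLieAlgebra 𝓘(ℝ, E) G :=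
    fun y => Ad E G (g y)⁻¹
  have ha : ContDiffAt ℝ ∞ a y₀ := by
    rw [← contMDiffAt_iff_contDiffAt]
    exact ContMDiffAt.comp (I' := 𝓘(ℝ, E)) y₀ contMDiff_Ad.contMDiffAt hg
  have hai : ContDiffAt ℝ ∞ ai y₀ := by
    rw [← contMDiffAt_iff_contDiffAt]
    exact ContMDiffAt.comp (I' := 𝓘(ℝ, E)) (g := fun x : G => Ad E G x⁻¹) y₀
      contMDiff_Ad_inv.contMDiffAt hg
  have hda : ContDiffAt ℝ ∞ (fderiv ℝ a) y₀ := ha.fderiv_right (by simp)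
  let M := ContinuousLinearMap.mul ℝ (GroupLieAlgebra 𝓘(ℝ, E) G →L[ℝ] GroupLieAlgebra 𝓘(ℝ, E) G)
  -- The 1-form `B(X, g⁻¹ dg)`, with `g⁻¹ dg` seen through `Ad`.
  let h : F → F →L[ℝ] ℝ := fun y => (traceAd X).comp ((M (ai y)).comp (fderiv ℝ a y))
  have hM : ContDiff ℝ ∞ M := ContinuousLinearMap.contDiff _
  have hh : ContDiffAt ℝ ∞ h y₀ :=
    contDiffAt_const.clm_comp ((hM.contDiffAt.comp y₀ hai).clm_comp hda)
  let β : F → F [⋀^Fin 1]→L[ℝ] ℝ := fun y =>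
    ContinuousAlternatingMap.ofSubsingletonLIE (𝕜 := ℝ) (E := F) (F := ℝ) (0 : Fin 1) (h y)
  have hβ : ContDiffAt ℝ ∞ β y₀ :=
    (ContinuousAlternatingMap.ofSubsingletonLIE (𝕜 := ℝ) (E := F) (F := ℝ)
      (0 : Fin 1)).toContinuousLinearEquiv.contDiff.contDiffAt.comp y₀ hh
  have key : τ =ᶠ[𝓝 y₀] extDeriv β := by
    have e1 : ∀ᶠ y in 𝓝 y₀, ContDiffAt ℝ 2 a y :=
      (ha.of_le (m := 2) ENat.LEInfty.out).eventually (by simp)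
    filter_upwards [hν.eventually_nhds, hτ, e1, hai.eventually_differentiableAt_infty,
      hda.eventually_differentiableAt_infty, hh.eventually_differentiableAt_infty,
      hg.eventually_mdifferentiableAt] with y hνy hτy hay haiy hday hhy hgy
    have hDai : ∀ b, fderiv ℝ ai y b = -(ai y * fderiv ℝ a y b * ai y) := by
      intro b
      have h1 := haiy.hasFDerivAt.mul' (hay.differentiableAt (by simp)).hasFDerivAt
      have h2 : ai * a = fun _ => 1 := funext fun x => Ad_inv_mul (g x)
      rw [h2] at h1
      have h3 : ai y * fderiv ℝ a y b + fderiv ℝ ai y b * a y = 0 :=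
        ContinuousLinearMap.ext_iff.1 (h1.unique (hasFDerivAt_const _ y)) b
      have h4 : a y * ai y = 1 := Ad_mul_inv (g y)
      calc fderiv ℝ ai y b = fderiv ℝ ai y b * a y * ai y := by rw [mul_assoc, h4, mul_one]
        _ = -(ai y * fderiv ℝ a y b * ai y) := by
          rw [eq_neg_of_add_eq_zero_right h3, neg_mul]
    have hDh : ∀ b c, fderiv ℝ (fun x => h x c) y b =
        traceAd X (-(ai y * fderiv ℝ a y b * ai y) * fderiv ℝ a y c) +
          traceAd X (ai y * fderiv ℝ (fderiv ℝ a) y b c) := by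
      intro b c
      have h1 : HasFDerivAt (fun x => fderiv ℝ a x c) ((fderiv ℝ (fderiv ℝ a) y).flip c) y := by
        refine (hday.hasFDerivAt.clm_apply (hasFDerivAt_const c y)).congr_fderiv ?_
        ext w
        simp
      have h2 := ((traceAd X).hasFDerivAt.comp y (haiy.hasFDerivAt.mul' h1)).fderiv
      refine (ContinuousLinearMap.ext_iff.1 h2 b).trans ?_
      rw [← hDai, add_comm, ← map_add]
      rfl
    -- One and the same `ξ` describes the derivative of `Ad ∘ g` and that of `ν`, which links `dβ`
    -- to `hτ`.
    have hfund : ∀ b, ∃ ξ : GroupLieAlgebra 𝓘(ℝ, E) G, fderiv ℝ a y b = adCLM ξ * a y ∧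
        fderiv ℝ ν y b = fundamentalField (coAd E G) ξ (ν y) := by
      intro b
      obtain ⟨ξ, hξ⟩ := exists_fderiv_Ad_comp hgy b
      refine ⟨ξ, hξ, ?_⟩
      let L := ContinuousLinearMap.compL ℝ (GroupLieAlgebra 𝓘(ℝ, E) G)
        (GroupLieAlgebra 𝓘(ℝ, E) G) ℝ (killingFlat E G X)
      have h1 : HasFDerivAt ν (L.comp (fderiv ℝ ai y)) y :=
        (L.hasFDerivAt.comp y haiy.hasFDerivAt).congr_of_eventuallyEq hνy
      rw [h1.fderiv]
      ext Y
      rw [fundamentalField_coAd_apply, hνy.self_of_nhds]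
      change killingFlat E G X (fderiv ℝ ai y b Y) = -(killingFlat E G X (ai y ⁅ξ, Y⁆))
      have h4 : a y * ai y = 1 := Ad_mul_inv (g y)
      rw [hDai, show fderiv ℝ a y b = adCLM ξ * a y from hξ, mul_assoc, mul_assoc, h4, mul_one,
        neg_apply, map_neg]
      rfl
    ext v
    have hv : v = ![v 0, v 1] := by
      ext i
      fin_cases i <;> rfl
    rw [hv]
    obtain ⟨ξ, hξ, hξν⟩ := hfund (v 0)
    obtain ⟨η, hη, hην⟩ := hfund (v 1)
    have hsymm : fderiv ℝ (fderiv ℝ a) y (v 0) (v 1) = fderiv ℝ (fderiv ℝ a) y (v 1) (v 0) :=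
      (hay.isSymmSndFDerivAt (by rw [minSmoothness_of_isRCLikeNormedField])).eq _ _
    rw [hτy _ _ ξ η hξν hην, extDeriv_ofSubsingleton_apply hhy, hDh, hDh, hsymm, hνy.self_of_nhds,
      coAd_apply, killingFlat_eq_traceAd, adCLM_Ad, inv_inv, adCLM_lie]
    rw [add_sub_add_right_eq_sub, ← map_sub, ← map_neg, hξ, hη]
    congr 1
    change -(ai y * _ * a y) = _
    have h4 : a y * ai y = 1 := Ad_mul_inv (g y)
    -- The second derivatives of `a` have cancelled by symmetry. With `Da(b) = ad ξ ∘ a` and `Da(c)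
    -- = ad η ∘ a`, what remains is the commutator of `ad ξ` and `ad η`, conjugated by `a`.
    have h5 : ∀ P Q : GroupLieAlgebra 𝓘(ℝ, E) G →L[ℝ] GroupLieAlgebra 𝓘(ℝ, E) G,
        -(ai y * (P * a y) * ai y) * (Q * a y) = -(ai y * (P * Q) * a y) := by
      intro P Q
      calc -(ai y * (P * a y) * ai y) * (Q * a y) = -(ai y * P * (a y * ai y) * Q * a y) := by
            noncomm_ring
        _ = -(ai y * (P * Q) * a y) := by rw [h4]; noncomm_ring
    rw [h5, h5]
    noncomm_ring
  have hdβ : ContDiffAt ℝ ∞ (extDeriv β) y₀ := by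
    have h1 : ContDiffAt ℝ ∞ (fderiv ℝ β) y₀ := hβ.fderiv_right (by simp)
    exact (ContinuousAlternatingMap.alternatizeUncurryFinCLM ℝ F ℝ).contDiff.contDiffAt.comp y₀ h1
  refine ⟨hdβ.congr_of_eventuallyEq key, ?_⟩
  rw [key.extDeriv_eq]
  exact extDeriv_extDeriv_apply hβ (by
    rw [minSmoothness_of_isRCLikeNormedField]; exact ENat.LEInfty.out)

end KKSForms

/-! ### Orbit maps of a compact Lie group: constant rank and local sections -/

section SmoothOrbits

open Filter Topology

variable {E : Type*} [NormedAddCommGroup E] [NormedSpace ℝ E]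
  {G : Type*} [TopologicalSpace G] [ChartedSpace E G] [Group G]
  {V : Type*} [NormedAddCommGroup V] [NormedSpace ℝ V] {ρ : G →* (V →L[ℝ] V)}

theorem orbit_map_mul (g h : G) (v : V) : ρ (g * h) v = ρ g (ρ h v) := by
  rw [map_mul]
  rfl

theorem orbit_map_mem (g : G) (v : V) : ρ g v ∈ orbit ρ v := ⟨g, rfl⟩

theorem orbit_eq_of_mem {v w : V} (hw : w ∈ orbit ρ v) : orbit ρ w = orbit ρ v := by
  obtain ⟨g, rfl⟩ := hw
  ext u
  constructor
  · rintro ⟨h, rfl⟩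
    exact ⟨h * g, orbit_map_mul h g v⟩
  · rintro ⟨h, rfl⟩
    refine ⟨h * g⁻¹, ?_⟩
    change ρ (h * g⁻¹) (ρ g v) = ρ h v
    rw [← orbit_map_mul, inv_mul_cancel_right]

/-- The image of a neighbourhood of `1` under the orbit map of a compact group is a neighbourhood in
the orbit. -/
theorem image_mem_nhdsWithin_orbit [IsTopologicalGroup G] [CompactSpace G] {v : V}
    (hρ : Continuous fun g => ρ g v) {N : Set G} (hN : N ∈ 𝓝 (1 : G)) :
    (fun g => ρ g v) '' N ∈ 𝓝[orbit ρ v] v := by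
  -- `U` is the interior of `N` multiplied by the stabilizer of `v`. Its complement is compact, so
  -- the image of the complement is closed; it misses `v`, since `U` contains the stabilizer.
  let U : Set G := ⋃ s ∈ {s : G | ρ s v = v}, (fun g => g * s⁻¹) ⁻¹' interior N
  have hU : IsOpen U := isOpen_biUnion fun s _ =>
    isOpen_interior.preimage (continuous_mul_const _)
  have hK : IsClosed ((fun g => ρ g v) '' Uᶜ) :=
    (hU.isClosed_compl.isCompact.image hρ).isClosed
  have hv : v ∉ (fun g => ρ g v) '' Uᶜ := by
    rintro ⟨k, hk, hkv⟩
    refine hk (Set.mem_biUnion (x := k) hkv ?_)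
    change k * k⁻¹ ∈ interior N
    rw [mul_inv_cancel]
    exact mem_interior_iff_mem_nhds.2 hN
  filter_upwards [mem_nhdsWithin_of_mem_nhds (hK.isOpen_compl.mem_nhds hv), self_mem_nhdsWithin]
    with w hw hwo
  obtain ⟨g, rfl⟩ := hwo
  have hg : g ∈ U := by
    by_contra h
    exact hw ⟨g, h, rfl⟩
  obtain ⟨s, hs, hgs⟩ := Set.mem_iUnion₂.1 hg
  refine ⟨g * s⁻¹, interior_subset hgs, ?_⟩
  have h1 : ρ s⁻¹ v = v := by
    have h2 : ρ s⁻¹ (ρ s v) = v := by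
      rw [← orbit_map_mul, inv_mul_cancel, map_one]
      rfl
    rwa [show ρ s v = v from hs] at h2
  change ρ (g * s⁻¹) v = ρ g v
  rw [orbit_map_mul, h1]

/-- The derivative at `1` of the orbit map. -/
noncomputable def fundamentalMap (ρ : G →* (V →L[ℝ] V)) (v : V) :
    GroupLieAlgebra 𝓘(ℝ, E) G →L[ℝ] V :=
  mfderiv 𝓘(ℝ, E) 𝓘(ℝ, V) (fun g : G => ρ g v) 1

variable [LieGroup 𝓘(ℝ, E) ∞ G]

theorem contMDiff_orbitMap (hρ : ContMDiff 𝓘(ℝ, E) 𝓘(ℝ, V →L[ℝ] V) ∞ ρ) (v : V) :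
    ContMDiff 𝓘(ℝ, E) 𝓘(ℝ, V) ∞ fun g : G => ρ g v := by
  have h : ContDiff ℝ ∞ (ContinuousLinearMap.apply ℝ V v) := ContinuousLinearMap.contDiff _
  exact h.contMDiff.comp hρ

section Derivatives

variable {F : Type*} [NormedAddCommGroup F] [NormedSpace ℝ F]
  {M : Type*} [TopologicalSpace M] [ChartedSpace F M] {k : M → G} {y : M}

theorem mfderiv_orbitMap_comp (hρ : ContMDiff 𝓘(ℝ, E) 𝓘(ℝ, V →L[ℝ] V) ∞ ρ) (v : V)
    (hk : MDifferentiableAt 𝓘(ℝ, F) 𝓘(ℝ, E) k y) (hy : k y = 1) (b : TangentSpace 𝓘(ℝ, F) y) :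
    mfderiv 𝓘(ℝ, F) 𝓘(ℝ, V) (fun x => ρ (k x) v) y b =
      fundamentalField ρ (show GroupLieAlgebra 𝓘(ℝ, E) G from mfderiv 𝓘(ℝ, F) 𝓘(ℝ, E) k y b) v := by
  have h0 : MDifferentiableAt 𝓘(ℝ, E) 𝓘(ℝ, V) (fun g : G => ρ g v) 1 :=
    (contMDiff_orbitMap hρ v).contMDiffAt.mdifferentiableAt (by simp)
  have h1 := mfderiv_comp_of_eq h0 hk hy
  have h2 : ∀ g : G, g = 1 → ∀ ξ : E,
      (mfderiv 𝓘(ℝ, E) 𝓘(ℝ, V) (fun g : G => ρ g v) g ξ : V) =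
      fundamentalField ρ (show GroupLieAlgebra 𝓘(ℝ, E) G from ξ) v := by
    rintro _ rfl ξ
    rfl
  exact (ContinuousLinearMap.ext_iff.1 h1 b).trans (h2 _ hy _)

/-- Translating `k` on the left by `(k y)⁻¹` reduces to a map through `1`. Hence all derivatives of
the orbit map have range in a translate of one fixed subspace, which bounds the rank. -/
theorem exists_mfderiv_orbitMap_comp (hρ : ContMDiff 𝓘(ℝ, E) 𝓘(ℝ, V →L[ℝ] V) ∞ ρ) (v : V)
    (hk : MDifferentiableAt 𝓘(ℝ, F) 𝓘(ℝ, E) k y) (b : TangentSpace 𝓘(ℝ, F) y) :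
    ∃ ξ : GroupLieAlgebra 𝓘(ℝ, E) G, mfderiv 𝓘(ℝ, F) 𝓘(ℝ, V) (fun x => ρ (k x) v) y b =
      ρ (k y) (fundamentalField ρ ξ v) := by
  have hk' : MDifferentiableAt 𝓘(ℝ, F) 𝓘(ℝ, E) (fun x => (k y)⁻¹ * k x) y :=
    MDifferentiableAt.comp (I' := 𝓘(ℝ, E)) y
      ((contMDiff_mul_left (I := 𝓘(ℝ, E)) (n := ∞) (a := (k y)⁻¹)).contMDiffAt.mdifferentiableAt
        (by simp)) hk
  refine ⟨mfderiv 𝓘(ℝ, F) 𝓘(ℝ, E) (fun x => (k y)⁻¹ * k x) y b, ?_⟩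
  have h2 : (fun x => ρ (k x) v) = ρ (k y) ∘ fun x => ρ ((k y)⁻¹ * k x) v := by
    ext1 x
    change _ = ρ (k y) (ρ ((k y)⁻¹ * k x) v)
    rw [← orbit_map_mul, mul_inv_cancel_left]
  rw [h2]
  have h0 : MDifferentiableAt 𝓘(ℝ, F) 𝓘(ℝ, V) (fun x => ρ ((k y)⁻¹ * k x) v) y :=
    MDifferentiableAt.comp (I' := 𝓘(ℝ, E)) (g := fun g : G => ρ g v) y
      ((contMDiff_orbitMap hρ v).contMDiffAt.mdifferentiableAt (by simp)) hk'
  have h3 := ((ρ (k y)).hasMFDerivAt.comp y h0.hasMFDerivAt).mfderiv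
  exact (ContinuousLinearMap.ext_iff.1 h3 b).trans
    (congrArg (ρ (k y)) (mfderiv_orbitMap_comp hρ v hk' (by simp) b))

end Derivatives

/-- The dimension of the tangent space of the orbit. -/
noncomputable def orbitRank (ρ : G →* (V →L[ℝ] V)) (v : V) : ℕ :=
  Module.finrank ℝ (fundamentalMap (E := E) ρ v).toLinearMap.range

variable [FiniteDimensional ℝ V]

theorem orbitRank_le (hρ : ContMDiff 𝓘(ℝ, E) 𝓘(ℝ, V →L[ℝ] V) ∞ ρ) (g : G) (v : V) :
    orbitRank (E := E) ρ (ρ g v) ≤ orbitRank (E := E) ρ v := by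
  refine le_trans (Submodule.finrank_mono ?_)
    (Submodule.finrank_map_le (ρ g).toLinearMap (fundamentalMap (E := E) ρ v).toLinearMap.range)
  rintro _ ⟨ξ, rfl⟩
  have hk : MDifferentiableAt 𝓘(ℝ, E) 𝓘(ℝ, E) (fun x : G => x * g) 1 :=
    (contMDiff_mul_right (I := 𝓘(ℝ, E)) (n := ∞) (a := g)).contMDiffAt.mdifferentiableAt (by simp)
  obtain ⟨η, hη⟩ := exists_mfderiv_orbitMap_comp hρ v hk ξ
  have h : (fun x : G => ρ (x * g) v) = fun x => ρ x (ρ g v) :=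
    funext fun x => orbit_map_mul x g v
  rw [h, one_mul] at hη
  exact ⟨fundamentalMap ρ v η, ⟨η, rfl⟩, hη.symm⟩

theorem orbitRank_eq_of_mem (hρ : ContMDiff 𝓘(ℝ, E) 𝓘(ℝ, V →L[ℝ] V) ∞ ρ) {v w : V}
    (hw : w ∈ orbit ρ v) : orbitRank (E := E) ρ w = orbitRank (E := E) ρ v := by
  obtain ⟨g, rfl⟩ := hw
  refine le_antisymm (orbitRank_le hρ g v) ?_
  have h := orbitRank_le hρ g⁻¹ (ρ g v)
  rwa [← orbit_map_mul, inv_mul_cancel, map_one] at h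

/-- A smooth local section of the orbit map of a compact Lie group, factoring through linear
coordinates on the orbit. -/
theorem exists_orbit_section [FiniteDimensional ℝ E] [CompactSpace G]
    (hρ : ContMDiff 𝓘(ℝ, E) 𝓘(ℝ, V →L[ℝ] V) ∞ ρ) (v : V) {d : ℕ}
    (hd : orbitRank (E := E) ρ v = d) :
    ∃ (P : V →L[ℝ] EuclideanSpace ℝ (Fin d)) (γ : EuclideanSpace ℝ (Fin d) → G),
      (∀ᶠ t in 𝓝 (P v), ContMDiffAt (𝓡 d) 𝓘(ℝ, E) ∞ γ t) ∧ γ (P v) = 1 ∧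
      (∀ᶠ t in 𝓝 (P v), P (ρ (γ t) v) = t) ∧
      ∀ᶠ w in 𝓝[orbit ρ v] v, ρ (γ (P w)) v = w := by
  have hTG : IsTopologicalGroup G := topologicalGroup_of_lieGroup 𝓘(ℝ, E) ∞
  set φ := extChartAt 𝓘(ℝ, E) (1 : G) with hφ
  let f : E → V := fun x => ρ (φ.symm x) v
  have hφs : ContMDiffAt 𝓘(ℝ, E) 𝓘(ℝ, E) ∞ φ.symm (φ 1) := contMDiffAt_chartOne_symm
  have hφe : φ.symm (φ 1) = 1 := chartOne_symm
  have hf1 : f (φ 1) = v := by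
    change ρ (φ.symm (φ 1)) v = v
    rw [hφe, map_one]
    rfl
  have hφs' : ∀ᶠ x in 𝓝 (φ 1), ContMDiffAt 𝓘(ℝ, E) 𝓘(ℝ, E) ∞ φ.symm x := by
    filter_upwards [(isOpen_extChartAt_target (I := 𝓘(ℝ, E)) (1 : G)).mem_nhds
      (mem_extChartAt_target (I := 𝓘(ℝ, E)) (1 : G))] with x hx
    exact (contMDiffOn_extChartAt_symm (I := 𝓘(ℝ, E)) (1 : G)).contMDiffAt
      ((isOpen_extChartAt_target (I := 𝓘(ℝ, E)) (1 : G)).mem_nhds hx)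
  have hf : ∀ᶠ x in 𝓝 (φ 1), ContDiffAt ℝ ∞ f x := by
    filter_upwards [hφs'] with x hx
    rw [← contMDiffAt_iff_contDiffAt]
    exact ContMDiffAt.comp (I' := 𝓘(ℝ, E)) (g := fun g : G => ρ g v) _
      (contMDiff_orbitMap hρ v).contMDiffAt hx
  have hfd : fderiv ℝ f (φ 1) = (fundamentalMap (E := E) ρ v : E →L[ℝ] V) := by
    exact ((contMDiff_orbitMap hρ v).contMDiffAt.mdifferentiableAt
      (by simp)).mfderiv_eq_fderiv_chart.symm
  have hr : ∀ᶠ x in 𝓝 (φ 1), Module.finrank ℝ (fderiv ℝ f x).toLinearMap.range ≤ d := by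
    filter_upwards [hφs.eventually_mdifferentiableAt] with x hx
    rw [← hd]
    refine le_trans (Submodule.finrank_mono ?_)
      (Submodule.finrank_map_le (ρ (φ.symm x)).toLinearMap
        (fundamentalMap (E := E) ρ v).toLinearMap.range)
    rintro _ ⟨b, rfl⟩
    obtain ⟨η, hη⟩ := exists_mfderiv_orbitMap_comp hρ v hx b
    rw [mfderiv_eq_fderiv] at hη
    exact ⟨fundamentalMap ρ v η, ⟨η, rfl⟩, hη.symm⟩
  obtain ⟨P, γ, hγ, hγe, hPγ, hγP⟩ := exists_factorization_of_rank_le hf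
    (d := d) (by rw [hfd]; exact hd) hr
  rw [hf1] at hγ hγe hPγ
  refine ⟨P, fun t => φ.symm (γ t), ?_, ?_, hPγ, ?_⟩
  · have hc : Tendsto γ (𝓝 (P v)) (𝓝 (φ 1)) := by
      have := hγ.self_of_nhds.continuousAt
      rwa [ContinuousAt, hγe] at this
    filter_upwards [hγ, hc.eventually hφs'] with t ht ht'
    exact ContMDiffAt.comp (I' := 𝓘(ℝ, E)) (g := φ.symm) _ ht' ht.contMDiffAt
  · change φ.symm (γ (P v)) = 1
    rw [hγe, hφe]
  · have h1 : ∀ᶠ g in 𝓝 (1 : G), ρ (φ.symm (γ (P (ρ g v)))) v = ρ g v := by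
      have hc : ContinuousAt φ 1 := continuousAt_extChartAt (I := 𝓘(ℝ, E)) (1 : G)
      filter_upwards [hc.eventually hγP, extChartAt_source_mem_nhds (I := 𝓘(ℝ, E)) (1 : G)]
        with g hg hgs
      change ρ (φ.symm (γ (P (ρ (φ.symm (φ g)) v)))) v = ρ (φ.symm (φ g)) v at hg
      rwa [φ.left_inv hgs] at hg
    -- Compactness enters here: an identity valid for `g` near `1` becomes one valid for orbit
    -- points near `v`.
    filter_upwards [image_mem_nhdsWithin_orbit (contMDiff_orbitMap hρ v).continuous h1] with w hw
    obtain ⟨g, hg, rfl⟩ := hw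
    exact hg

end SmoothOrbits

/-! ### Slice charts from parametrizations -/

section LocalParametrizations

open Filter Topology

variable {V : Type*} [NormedAddCommGroup V] [NormedSpace ℝ V] [FiniteDimensional ℝ V]

/-- The range of `s` is completed by a complement, whose dimension `finrank V - d` is a true
difference because `s` is injective. This is the linear model of an immersion. -/
theorem exists_equiv_prod_apply_zero {d : ℕ} (s : EuclideanSpace ℝ (Fin d) →ₗ[ℝ] V)
    (hs : Function.Injective s) :
    ∃ L : (EuclideanSpace ℝ (Fin d) × EuclideanSpace ℝ (Fin (Module.finrank ℝ V - d))) ≃L[ℝ] V,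
      ∀ t, L (t, 0) = s t := by
  obtain ⟨C, hC⟩ := Submodule.exists_isCompl s.range
  let e := LinearEquiv.ofInjective s hs
  have h1 : Module.finrank ℝ s.range = d := by
    rw [← e.finrank_eq, finrank_euclideanSpace_fin]
  have h2 := Submodule.finrank_add_eq_of_isCompl hC
  let k : EuclideanSpace ℝ (Fin (Module.finrank ℝ V - d)) ≃ₗ[ℝ] C :=
    LinearEquiv.ofFinrankEq _ _ (by rw [finrank_euclideanSpace_fin]; omega)
  refine ⟨((e.prodCongr k).trans (Submodule.prodEquivOfIsCompl _ C hC)).toContinuousLinearEquiv,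
    fun t => ?_⟩
  simp [e]

variable {S : Set V} {d : ℕ}

/-- A subset with a smooth parametrization inverse to linear coordinates has a slice chart. -/
theorem exists_slice_chart {P : V →L[ℝ] EuclideanSpace ℝ (Fin d)}
    {h : EuclideanSpace ℝ (Fin d) → V} (hS : ∀ t, h t ∈ S) (v : S)
    (hh : ∀ᶠ t in 𝓝 (P v), ContDiffAt ℝ ∞ h t)
    (hP : ∀ᶠ t in 𝓝 (P v), P (h t) = t) (hhP : ∀ᶠ w in 𝓝[S] (v : V), h (P w) = w) :
    ∃ (c : OpenPartialHomeomorph S (EuclideanSpace ℝ (Fin d))) (ψ : OpenPartialHomeomorph V V)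
      (L : (EuclideanSpace ℝ (Fin d) × EuclideanSpace ℝ (Fin (Module.finrank ℝ V - d))) ≃L[ℝ] V),
      v ∈ c.source ∧ (v : V) ∈ ψ.source ∧ ψ ∈ IsManifold.maximalAtlas 𝓘(ℝ, V) ∞ V ∧
      (∀ p, c p = P p) ∧ (∀ t, (c.symm t : V) = h t) ∧ (∀ t ∈ c.target, ContDiffAt ℝ ∞ h t) ∧
      ∀ t ∈ c.target, ψ (h t) = L (t, 0) := by
  obtain ⟨U, hU, hUo, hvU⟩ := eventually_nhds_iff.1 (hh.and hP)
  obtain ⟨N, hN, hNo, hvN⟩ := eventually_nhds_iff.1 (eventually_nhdsWithin_iff.1 hhP)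
  have hcont : ContinuousOn h U := fun t ht => (hU t ht).1.continuousAt.continuousWithinAt
  let c : OpenPartialHomeomorph S (EuclideanSpace ℝ (Fin d)) :=
    { toFun := fun p => P p
      invFun := fun t => ⟨h t, hS t⟩
      source := {p | (p : V) ∈ N ∧ P p ∈ U}
      target := U ∩ h ⁻¹' N
      map_source' := by
        rintro p ⟨hp1, hp2⟩
        refine ⟨hp2, ?_⟩
        change h (P p) ∈ N
        rwa [hN p hp1 p.2]
      map_target' := by
        rintro t ⟨ht1, ht2⟩
        refine ⟨ht2, ?_⟩
        change P (h t) ∈ U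
        rwa [(hU t ht1).2]
      left_inv' := by
        rintro p ⟨hp1, hp2⟩
        exact Subtype.ext (hN p hp1 p.2)
      right_inv' := by
        rintro t ⟨ht1, ht2⟩
        exact (hU t ht1).2
      open_source := (hNo.preimage continuous_subtype_val).inter
        (hUo.preimage (P.continuous.comp continuous_subtype_val))
      open_target := hcont.isOpen_inter_preimage hUo hNo
      continuousOn_toFun := (P.continuous.comp continuous_subtype_val).continuousOn
      continuousOn_invFun := Topology.IsInducing.subtypeVal.continuousOn_iff.2
        (hcont.mono Set.inter_subset_left) }
  have hdh : ∀ t, P (fderiv ℝ h (P v) t) = t := by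
    have h1 := P.hasFDerivAt.comp (P v) (hh.self_of_nhds.differentiableAt (by simp)).hasFDerivAt
    have h2 := h1.unique ((hasFDerivAt_id (P v)).congr_of_eventuallyEq hP)
    exact ContinuousLinearMap.ext_iff.1 h2
  let s := fderiv ℝ h (P v)
  obtain ⟨L, hL⟩ := exists_equiv_prod_apply_zero s.toLinearMap
    (Function.LeftInverse.injective (g := P) hdh)
  have hPs : ∀ t, P (s t) = t := hdh
  have hhU : ContDiffOn ℝ ∞ (fun w => h (P w)) (P ⁻¹' U) := fun w hw =>
    ((hU _ hw).1.comp w P.contDiff.contDiffAt).contDiffWithinAt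
  have hsP : ContDiff ℝ ∞ fun w => s (P w) := (s.comp P).contDiff
  have hto : ContDiffOn ℝ ∞ (fun w => s (P w) + (w - h (P w))) (P ⁻¹' U) :=
    hsP.contDiffOn.add (contDiffOn_id.sub hhU)
  have hinv : ContDiffOn ℝ ∞ (fun w => h (P w) + (w - s (P w))) (P ⁻¹' U) :=
    hhU.add (contDiffOn_id.sub hsP.contDiffOn)
  have hPto : ∀ w ∈ P ⁻¹' U, P (s (P w) + (w - h (P w))) = P w := fun w hw => by
    rw [map_add, map_sub, hPs, (hU _ hw).2]
    abel
  have hPinv : ∀ w ∈ P ⁻¹' U, P (h (P w) + (w - s (P w))) = P w := fun w hw => by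
    rw [map_add, map_sub, hPs, (hU _ hw).2]
    abel
  -- A shear replacing the curved slice `h t` by the linear one `s t`. As `P ∘ s` and `P ∘ h` are
  -- both the identity, it preserves `P`, and the opposite shear inverts it.
  let ψ : OpenPartialHomeomorph V V :=
    { toFun := fun w => s (P w) + (w - h (P w))
      invFun := fun w => h (P w) + (w - s (P w))
      source := P ⁻¹' U
      target := P ⁻¹' U
      map_source' := fun w hw => by
        rw [Set.mem_preimage, hPto w hw]
        exact hw
      map_target' := fun w hw => by
        rw [Set.mem_preimage, hPinv w hw]
        exact hw
      left_inv' := fun w hw => by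
        rw [hPto w hw]
        abel
      right_inv' := fun w hw => by
        rw [hPinv w hw]
        abel
      open_source := hUo.preimage P.continuous
      open_target := hUo.preimage P.continuous
      continuousOn_toFun := hto.continuousOn
      continuousOn_invFun := hinv.continuousOn }
  refine ⟨c, ψ, L, ⟨hvN, hvU⟩, hvU, ?_, fun _ => rfl, fun _ => rfl,
    fun t ht => (hU t ht.1).1, fun t ht => ?_⟩
  · refine StructureGroupoid.mem_maximalAtlas_of_mem_groupoid _ ?_
    rw [contDiffGroupoid, mem_groupoid_of_pregroupoid]
    constructor
    · have : ContDiffOn ℝ ∞ ψ ψ.source := hto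
      simpa [contDiffPregroupoid] using this
    · have : ContDiffOn ℝ ∞ ψ.symm ψ.target := hinv
      simpa [contDiffPregroupoid] using this
  · have h1 : P (h t) = t := (hU t ht.1).2
    change s (P (h t)) + (h t - h (P (h t))) = _
    rw [h1, sub_self, add_zero]
    exact (hL t).symm

/-- A subset which near each of its points has a smooth parametrization inverse to linear
coordinates is an embedded submanifold. -/
theorem isEmbeddedSubmanifold_of_local_parametrization
    (H : ∀ v : S, ∃ (P : V →L[ℝ] EuclideanSpace ℝ (Fin d)) (h : EuclideanSpace ℝ (Fin d) → V),
      (∀ t, h t ∈ S) ∧ (∀ᶠ t in 𝓝 (P v), ContDiffAt ℝ ∞ h t) ∧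
      (∀ᶠ t in 𝓝 (P v), P (h t) = t) ∧ ∀ᶠ w in 𝓝[S] (v : V), h (P w) = w) :
    IsEmbeddedSubmanifold S := by
  choose P h hS hh hP hhP using H
  choose c ψ L hc hψ hψm hcP hch hhc hL using
    fun v => exists_slice_chart (hS v) v (hh v) (hP v) (hhP v)
  let inst : ChartedSpace (EuclideanSpace ℝ (Fin d)) S :=
    { atlas := Set.range c
      chartAt := c
      mem_chart_source := hc
      chart_mem_atlas := fun v => ⟨v, rfl⟩ }
  -- A transition map is `P w ∘ h v`, hence smooth.
  have hM : IsManifold (𝓡 d) ∞ S := by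
    refine isManifold_of_contDiffOn _ _ _ ?_
    rintro _ _ ⟨v, rfl⟩ ⟨w, rfl⟩
    intro t ht
    have ht' : t ∈ (c v).target := by
      have := ht.1
      simp only [modelWithCornersSelf_coe_symm, Set.preimage_id, mfld_simps] at this
      exact this.1
    refine ContDiffAt.contDiffWithinAt ?_
    have h1 : ContDiffAt ℝ ∞ (fun t => P w (h v t)) t :=
      (P w).contDiff.contDiffAt.comp t (hhc v t ht')
    convert h1 using 1
    ext1 t
    change c w ((c v).symm t) = _
    rw [hcP, hch]
  refine ⟨d, inst, hM, ⟨?_, Topology.IsEmbedding.subtypeVal⟩⟩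
  refine IsImmersionOfComplement.isImmersion
    (F := EuclideanSpace ℝ (Fin (Module.finrank ℝ V - d))) fun v => ?_
  refine IsImmersionAtOfComplement.mk_of_continuousAt continuous_subtype_val.continuousAt (L v)
    (c v) (ψ v) (hc v) (hψ v) (IsManifold.subset_maximalAtlas ⟨v, rfl⟩) (hψm v) ?_
  intro t ht
  have ht' : t ∈ (c v).target := by simpa using ht
  refine Eq.trans ?_ (hL v t ht')
  change ψ v ((c v).symm t : V) = _
  rw [hch]

end LocalParametrizations

/-! ### Orbits are embedded -/

section OrbitSubmanifold

variable {E : Type*} [NormedAddCommGroup E] [NormedSpace ℝ E] [FiniteDimensional ℝ E]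
  {G : Type*} [TopologicalSpace G] [ChartedSpace E G] [Group G] [LieGroup 𝓘(ℝ, E) ∞ G]
  [CompactSpace G]
  {V : Type*} [NormedAddCommGroup V] [NormedSpace ℝ V] [FiniteDimensional ℝ V]
  {ρ : G →* (V →L[ℝ] V)}

/-- The orbits of a smooth representation of a compact Lie group are embedded submanifolds. -/
theorem isEmbeddedSubmanifold_orbit (hρ : ContMDiff 𝓘(ℝ, E) 𝓘(ℝ, V →L[ℝ] V) ∞ ρ) (v : V) :
    IsEmbeddedSubmanifold (orbit ρ v) := by
  refine isEmbeddedSubmanifold_of_local_parametrization (d := orbitRank (E := E) ρ v) fun w => ?_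
  obtain ⟨P, γ, hγ, -, hPγ, hγP⟩ := exists_orbit_section hρ w.1 (orbitRank_eq_of_mem hρ w.2)
  rw [orbit_eq_of_mem w.2] at hγP
  refine ⟨P, fun t => ρ (γ t) w, fun t => ?_, ?_, hPγ, hγP⟩
  · exact (orbit_eq_of_mem w.2).subset (orbit_map_mem _ _)
  · filter_upwards [hγ] with t ht
    rw [← contMDiffAt_iff_contDiffAt]
    exact ContMDiffAt.comp (I' := 𝓘(ℝ, E)) (g := fun g : G => ρ g w.1) _
      (contMDiff_orbitMap hρ _).contMDiffAt ht

end OrbitSubmanifold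

/-! ### Maps into embedded submanifolds -/

section SubmanifoldStructures

open Filter Topology

variable {V : Type*} [NormedAddCommGroup V] [NormedSpace ℝ V]
  {S : Set V} {d : ℕ} [ChartedSpace (EuclideanSpace ℝ (Fin d)) S]
  {F : Type*} [NormedAddCommGroup F] [NormedSpace ℝ F]
  {M : Type*} [TopologicalSpace M] [ChartedSpace F M]

theorem IsSubmanifoldStructure.contMDiff_val (hS : IsSubmanifoldStructure S d) :
    ContMDiff (𝓡 d) 𝓘(ℝ, V) ∞ (Subtype.val : S → V) :=
  hS.2.isImmersion.contMDiff

theorem IsSubmanifoldStructure.mdifferentiableAt_val (hS : IsSubmanifoldStructure S d) (p : S) :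
    MDifferentiableAt (𝓡 d) 𝓘(ℝ, V) (Subtype.val : S → V) p :=
  hS.contMDiff_val.contMDiffAt.mdifferentiableAt (by simp)

/-- A map into an embedded submanifold is smooth when it is smooth as a map into the ambient
space. -/
theorem IsSubmanifoldStructure.contMDiffAt_of_val [IsManifold 𝓘(ℝ, F) ∞ M]
    (hS : IsSubmanifoldStructure S d) {f : M → S} {x : M}
    (hf : ContMDiffAt 𝓘(ℝ, F) 𝓘(ℝ, V) ∞ (fun y => (f y : V)) x) :
    ContMDiffAt 𝓘(ℝ, F) (𝓡 d) ∞ f x := by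
  have := hS.1
  rw [ContMDiffAt.iff_comp_isImmersionAt (hS.2.isImmersion.isImmersionAt (f x))]
  exact ⟨Topology.IsInducing.subtypeVal.continuousAt_iff.2 hf.continuousAt, hf⟩

theorem IsSubmanifoldStructure.mfderiv_val_comp (hS : IsSubmanifoldStructure S d) {f : M → S}
    {x : M} (hf : MDifferentiableAt 𝓘(ℝ, F) (𝓡 d) f x) (b : TangentSpace 𝓘(ℝ, F) x) :
    mfderiv 𝓘(ℝ, F) 𝓘(ℝ, V) (fun y => (f y : V)) x b =
      tangentInclusion S d (f x) (mfderiv 𝓘(ℝ, F) (𝓡 d) f x b) :=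
  ContinuousLinearMap.ext_iff.1 (mfderiv_comp x (hS.mdifferentiableAt_val (f x)) hf) b

/-- A linear isomorphism restricts to a diffeomorphism of embedded submanifolds. -/
theorem exists_diffeomorph_of_continuousLinearEquiv {W : Type*} [NormedAddCommGroup W]
    [NormedSpace ℝ W] {T : Set W} {d' : ℕ} [ChartedSpace (EuclideanSpace ℝ (Fin d')) T]
    (hS : IsSubmanifoldStructure S d) (hT : IsSubmanifoldStructure T d') (L : V ≃L[ℝ] W)
    (h1 : ∀ x ∈ S, L x ∈ T) (h2 : ∀ y ∈ T, L.symm y ∈ S) :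
    ∃ Φ : S ≃ₘ^∞⟮𝓡 d, 𝓡 d'⟯ T, ∀ x, (Φ x : W) = L x := by
  have := hS.1
  have := hT.1
  refine ⟨
    { toFun := fun x => ⟨L x, h1 x x.2⟩
      invFun := fun y => ⟨L.symm y, h2 y y.2⟩
      left_inv := fun x => Subtype.ext (L.symm_apply_apply x)
      right_inv := fun y => Subtype.ext (L.apply_symm_apply y)
      contMDiff_toFun := fun x => hT.contMDiffAt_of_val
        ((L.contDiff.contMDiff.comp hS.contMDiff_val) x)
      contMDiff_invFun := fun y => hS.contMDiffAt_of_val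
        ((L.symm.contDiff.contMDiff.comp hT.contMDiff_val) y) }, fun x => rfl⟩

end SubmanifoldStructures

/-! ### Tangent spaces of orbits -/

section OrbitTangentSpaces

open Filter Topology

variable {E : Type*} [NormedAddCommGroup E] [NormedSpace ℝ E] [FiniteDimensional ℝ E]
  {G : Type*} [TopologicalSpace G] [ChartedSpace E G] [Group G] [LieGroup 𝓘(ℝ, E) ∞ G]
  [CompactSpace G]
  {V : Type*} [NormedAddCommGroup V] [NormedSpace ℝ V] [FiniteDimensional ℝ V]
  {ρ : G →* (V →L[ℝ] V)} {v : V} {d : ℕ} [ChartedSpace (EuclideanSpace ℝ (Fin d)) (orbit ρ v)]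

/-- Composing with `P` defines the section on the ambient space, where its smoothness needs no
structure on the orbit. -/
theorem exists_smooth_orbit_section (hρ : ContMDiff 𝓘(ℝ, E) 𝓘(ℝ, V →L[ℝ] V) ∞ ρ) (v : V) :
    ∃ k : V → G, ContMDiffAt 𝓘(ℝ, V) 𝓘(ℝ, E) ∞ k v ∧ k v = 1 ∧
      ∀ᶠ w in 𝓝[orbit ρ v] v, ρ (k w) v = w := by
  obtain ⟨P, γ, hγ, hγ1, -, hγP⟩ := exists_orbit_section hρ v rfl
  refine ⟨fun w => γ (P w), ?_, hγ1, hγP⟩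
  exact ContMDiffAt.comp (I' := 𝓡 _) (g := γ) v hγ.self_of_nhds
    P.contDiff.contMDiff.contMDiffAt

/-- The section gives a map `w ↦ ρ (k w) p` from `V` into the orbit, smooth at `p` and equal to the
identity on the orbit near `p`. Its derivative is a left inverse of the tangent inclusion. -/
theorem tangentInclusion_orbit_injective (hρ : ContMDiff 𝓘(ℝ, E) 𝓘(ℝ, V →L[ℝ] V) ∞ ρ)
    (hS : IsSubmanifoldStructure (orbit ρ v) d) (p : orbit ρ v) :
    Function.Injective (tangentInclusion (orbit ρ v) d p) := by
  have := hS.1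
  obtain ⟨k, hk, hk1, hkw⟩ := exists_smooth_orbit_section hρ p.1
  rw [orbit_eq_of_mem p.2] at hkw
  have hr : ∀ w, ρ (k w) p.1 ∈ orbit ρ v := fun w =>
    (orbit_eq_of_mem p.2).subset (orbit_map_mem _ _)
  let r : V → orbit ρ v := fun w => ⟨ρ (k w) p.1, hr w⟩
  have hrs : ContMDiffAt 𝓘(ℝ, V) (𝓡 d) ∞ r p.1 := hS.contMDiffAt_of_val
    (ContMDiffAt.comp (I' := 𝓘(ℝ, E)) (g := fun g : G => ρ g p.1) p.1
      (contMDiff_orbitMap hρ p.1).contMDiffAt hk)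
  have h1 : (fun q : orbit ρ v => r q.1) =ᶠ[𝓝 p] id := by
    rw [eventually_nhdsWithin_iff] at hkw
    filter_upwards [continuous_subtype_val.continuousAt.eventually hkw] with q hq
    exact Subtype.ext (hq q.2)
  have h2 : mfderiv (𝓡 d) (𝓡 d) (fun q : orbit ρ v => r q.1) p =
      (mfderiv 𝓘(ℝ, V) (𝓡 d) r p.1).comp (tangentInclusion (orbit ρ v) d p) :=
    mfderiv_comp p (hrs.mdifferentiableAt (by simp)) (hS.mdifferentiableAt_val p)
  have h3 : ∀ u : EuclideanSpace ℝ (Fin d),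
      (mfderiv (𝓡 d) (𝓡 d) (fun q : orbit ρ v => r q.1) p u : EuclideanSpace ℝ (Fin d)) = u := by
    intro u
    have h4 := ((hasMFDerivAt_id (I := 𝓡 d) p).congr_of_eventuallyEq h1).mfderiv
    exact ContinuousLinearMap.ext_iff.1 h4 u
  intro u w huw
  have h5 := fun u => (ContinuousLinearMap.ext_iff.1 h2 u).symm.trans (h3 u)
  refine (h5 u).symm.trans (Eq.trans ?_ (h5 w))
  exact congrArg (mfderiv 𝓘(ℝ, V) (𝓡 d) r p.1) huw

/-- Tangent vectors of an orbit are values of fundamental vector fields, linearly. -/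
theorem exists_tangentInclusion_orbit_eq (hρ : ContMDiff 𝓘(ℝ, E) 𝓘(ℝ, V →L[ℝ] V) ∞ ρ)
    (hS : IsSubmanifoldStructure (orbit ρ v) d) (p : orbit ρ v) :
    ∃ L : TangentSpace (𝓡 d) p →L[ℝ] GroupLieAlgebra 𝓘(ℝ, E) G,
      ∀ u, tangentInclusion (orbit ρ v) d p u = fundamentalField ρ (L u) p.1 := by
  obtain ⟨k, hk, hk1, hkw⟩ := exists_smooth_orbit_section hρ p.1
  rw [orbit_eq_of_mem p.2] at hkw
  have h1 : (Subtype.val : orbit ρ v → V) =ᶠ[𝓝 p] fun q => ρ (k q.1) p.1 := by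
    rw [eventually_nhdsWithin_iff] at hkw
    filter_upwards [continuous_subtype_val.continuousAt.eventually hkw] with q hq
    exact (hq q.2).symm
  have h2 : MDifferentiableAt (𝓡 d) 𝓘(ℝ, E) (fun q : orbit ρ v => k q.1) p :=
    MDifferentiableAt.comp (I' := 𝓘(ℝ, V)) p (hk.mdifferentiableAt (by simp))
      (hS.mdifferentiableAt_val p)
  refine ⟨(mfderiv (𝓡 d) 𝓘(ℝ, E) (fun q : orbit ρ v => k q.1) p :), fun u => ?_⟩
  have h3 := mfderiv_orbitMap_comp hρ p.1 h2 hk1 u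
  refine Eq.trans ?_ h3
  exact ContinuousLinearMap.ext_iff.1 h1.mfderiv_eq u

/-- One inclusion comes from the local section; the other holds because the orbit map is
differentiable at `1` as a map into the orbit. -/
theorem range_tangentInclusion_orbit (hρ : ContMDiff 𝓘(ℝ, E) 𝓘(ℝ, V →L[ℝ] V) ∞ ρ)
    (hS : IsSubmanifoldStructure (orbit ρ v) d) (p : orbit ρ v) :
    Set.range (tangentInclusion (orbit ρ v) d p) =
      Set.range fun ξ : GroupLieAlgebra 𝓘(ℝ, E) G => fundamentalField ρ ξ p.1 := by
  have := hS.1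
  apply Set.Subset.antisymm
  · obtain ⟨L, hL⟩ := exists_tangentInclusion_orbit_eq hρ hS p
    rintro _ ⟨u, rfl⟩
    exact ⟨L u, (hL u).symm⟩
  · rintro _ ⟨ξ, rfl⟩
    let f : G → orbit ρ v := fun g =>
      ⟨ρ g p.1, (orbit_eq_of_mem p.2).subset (orbit_map_mem _ _)⟩
    have hf : MDifferentiableAt 𝓘(ℝ, E) (𝓡 d) f 1 :=
      (hS.contMDiffAt_of_val (contMDiff_orbitMap hρ p.1).contMDiffAt).mdifferentiableAt (by simp)
    have hf1 : f 1 = p := Subtype.ext (by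
      change ρ 1 p.1 = p.1
      rw [map_one]
      rfl)
    have h2 : ∀ q : orbit ρ v, q = p → ∀ u : EuclideanSpace ℝ (Fin d),
        (tangentInclusion (orbit ρ v) d q u : V) ∈
          Set.range (tangentInclusion (orbit ρ v) d p) := by
      rintro _ rfl u
      exact ⟨u, rfl⟩
    have h3 := hS.mfderiv_val_comp hf ξ
    obtain ⟨u, hu⟩ := h2 _ hf1 (mfderiv 𝓘(ℝ, E) (𝓡 d) f 1 ξ)
    exact ⟨u, hu.trans h3.symm⟩

end OrbitTangentSpaces

/-! ### The KKS form is symplectic -/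

section KirillovKostantSouriau

open Filter Topology

variable {E : Type*} [NormedAddCommGroup E] [NormedSpace ℝ E] [FiniteDimensional ℝ E]
  [CompleteSpace E]
  {G : Type*} [TopologicalSpace G] [ChartedSpace E G] [Group G] [LieGroup 𝓘(ℝ, E) ∞ G]

theorem continuous_adCLM :
    Continuous (adCLM : GroupLieAlgebra 𝓘(ℝ, E) G → _) :=
  LinearMap.continuous_of_finiteDimensional (𝕜 := ℝ)
    { toFun := (adCLM : GroupLieAlgebra 𝓘(ℝ, E) G → _)
      map_add' := fun ξ η => ContinuousLinearMap.ext fun Y => add_lie ξ η Y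
      map_smul' := fun c ξ => by
        ext Y
        exact smul_lie c ξ Y }

/-- The alternating form `(ξ, η) ↦ -ν [ξ, η]` on the Lie algebra. -/
noncomputable def negLieForm (ν : StrongDual ℝ (GroupLieAlgebra 𝓘(ℝ, E) G)) :
    GroupLieAlgebra 𝓘(ℝ, E) G [⋀^Fin 2]→L[ℝ] ℝ where
  toFun w := -(ν ⁅w 0, w 1⁆)
  map_update_add' w i x y := by
    fin_cases i <;> simp <;> ring
  map_update_smul' w i c x := by
    fin_cases i <;> simp
  cont := by
    have h : Continuous fun w : Fin 2 → GroupLieAlgebra 𝓘(ℝ, E) G => adCLM (w 0) :=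
      continuous_adCLM.comp (continuous_apply (0 : Fin 2))
    exact (ν.continuous.comp (h.clm_apply (continuous_apply (1 : Fin 2)))).neg
  map_eq_zero_of_eq' w i j hw hij := by
    have h : w 0 = w 1 := by
      fin_cases i <;> fin_cases j <;> first | exact absurd rfl hij | exact hw | exact hw.symm
    rw [h, lie_self, map_zero, neg_zero]

variable [CompactSpace G] {α : StrongDual ℝ (GroupLieAlgebra 𝓘(ℝ, E) G)} {d : ℕ}
  [ChartedSpace (EuclideanSpace ℝ (Fin d)) (orbit (coAd E G) α)]

/-- Tangent vectors are lifted linearly to `𝔤`. The lift is immaterial, since `ν([ξ, ·])` is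
determined by the value of the fundamental field of `ξ` at `ν`. -/
theorem exists_isKKSForm (hS : IsSubmanifoldStructure (orbit (coAd E G) α) d) :
    ∃ σ : TwoForm (EuclideanSpace ℝ (Fin d)) (orbit (coAd E G) α), IsKKSForm α d σ := by
  choose L hL using fun ν => exists_tangentInclusion_orbit_eq contMDiff_coAd hS ν
  refine ⟨fun ν => (negLieForm ν.1).compContinuousLinearMap (L ν), ?_⟩
  intro ν u v ξ η hu hv
  have h1 : ∀ (ξ ξ' Y : GroupLieAlgebra 𝓘(ℝ, E) G),
      fundamentalField (coAd E G) ξ ν.1 = fundamentalField (coAd E G) ξ' ν.1 →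
      ν.1 ⁅ξ, Y⁆ = ν.1 ⁅ξ', Y⁆ := by
    intro ξ ξ' Y h
    have h2 := ContinuousLinearMap.ext_iff.1 h Y
    rw [fundamentalField_coAd_apply, fundamentalField_coAd_apply] at h2
    exact neg_injective h2
  change -(ν.1 ⁅L ν u, L ν v⁆) = _
  rw [h1 (L ν u) ξ _ ((hL ν u).symm.trans hu), ← lie_skew, map_neg,
    h1 (L ν v) η _ ((hL ν v).symm.trans hv), ← map_neg, lie_skew]

variable {σ : TwoForm (EuclideanSpace ℝ (Fin d)) (orbit (coAd E G) α)}

/-- Pairing `u = ξ_{𝔤*}(ν)` with `Y_{𝔤*}(ν)` gives `-ν([ξ, Y])`, which is the value of `u` itself at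
`Y`. -/
theorem IsKKSForm.nondegenerate (hS : IsSubmanifoldStructure (orbit (coAd E G) α) d)
    (hσ : IsKKSForm α d σ) (ν : orbit (coAd E G) α) (u : TangentSpace (𝓡 d) ν)
    (hu : ∀ v : TangentSpace (𝓡 d) ν, σ ν ![u, v] = 0) : u = 0 := by
  obtain ⟨L, hL⟩ := exists_tangentInclusion_orbit_eq contMDiff_coAd hS ν
  refine tangentInclusion_orbit_injective contMDiff_coAd hS ν ?_
  rw [map_zero, hL u]
  ext Y
  rw [fundamentalField_coAd_apply]
  have h1 : fundamentalField (coAd E G) Y ν.1 ∈ Set.range (tangentInclusion _ d ν) := by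
    rw [range_tangentInclusion_orbit contMDiff_coAd hS]
    exact ⟨Y, rfl⟩
  obtain ⟨v, hv⟩ := h1
  rw [← hσ ν u v (L u) Y (hL u) hv, hu]
  rfl

/-- The pullback of the Kirillov-Kostant-Souriau form by a smooth map from a vector space is smooth
and closed. -/
theorem IsKKSForm.contDiffAt_and_extDeriv_eq_zero {F : Type*} [NormedAddCommGroup F]
    [NormedSpace ℝ F] (hG : Function.Surjective (killingFlat E G))
    (hS : IsSubmanifoldStructure (orbit (coAd E G) α) d)
    (hσ : IsKKSForm α d σ) {Ψ : F → orbit (coAd E G) α} {y₀ : F}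
    (hΨ : ∀ᶠ y in 𝓝 y₀, ContMDiffAt 𝓘(ℝ, F) (𝓡 d) ∞ Ψ y) {τ : F → F [⋀^Fin 2]→L[ℝ] ℝ}
    (hτ : ∀ᶠ y in 𝓝 y₀, ∀ b c : F, τ y ![b, c] =
      σ (Ψ y) ![mfderiv 𝓘(ℝ, F) (𝓡 d) Ψ y b, mfderiv 𝓘(ℝ, F) (𝓡 d) Ψ y c]) :
    ContDiffAt ℝ ∞ τ y₀ ∧ extDeriv τ y₀ = 0 := by
  -- The base point is taken as the image of `Ψ y₀`, not as `α`, so that a section near it is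
  -- available.
  obtain ⟨X, hX⟩ := hG (Ψ y₀).1
  obtain ⟨k, hk, hk1, hkw⟩ := exists_smooth_orbit_section (E := E) contMDiff_coAd (Ψ y₀).1
  rw [orbit_eq_of_mem (Ψ y₀).2] at hkw
  have hν : ContMDiffAt 𝓘(ℝ, F) 𝓘(ℝ, StrongDual ℝ (GroupLieAlgebra 𝓘(ℝ, E) G)) ∞
      (fun y => (Ψ y).1) y₀ :=
    ContMDiffAt.comp (I' := 𝓡 d) y₀ hS.contMDiff_val.contMDiffAt hΨ.self_of_nhds
  refine contDiffAt_and_extDeriv_eq_zero_of_kks (X := X) (g := fun y => k (Ψ y).1)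
    (ν := fun y => (Ψ y).1)
    (ContMDiffAt.comp (I' := 𝓘(ℝ, StrongDual ℝ (GroupLieAlgebra 𝓘(ℝ, E) G))) (g := k) y₀ hk hν)
    ?_ ?_
  · rw [eventually_nhdsWithin_iff] at hkw
    filter_upwards [hν.continuousAt.eventually hkw] with y hy
    rw [hX]
    exact (hy (Ψ y).2).symm
  · filter_upwards [hΨ, hτ] with y hy hτy b c ξ η hb hc
    have h1 := fun b : F => hS.mfderiv_val_comp (hy.mdifferentiableAt (by simp)) b
    rw [mfderiv_eq_fderiv] at h1
    rw [hτy]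
    exact hσ (Ψ y) _ _ ξ η ((h1 b).symm.trans hb) ((h1 c).symm.trans hc)

variable {d' : ℕ} {M : Type*} [TopologicalSpace M] [ChartedSpace (EuclideanSpace ℝ (Fin d')) M]
  [IsManifold (𝓡 d') ∞ M]

/-- The pullback of the Kirillov-Kostant-Souriau form by a diffeomorphism is symplectic. -/
theorem IsKKSForm.isSymplectic_pullback (hG : Function.Surjective (killingFlat E G))
    (hS : IsSubmanifoldStructure (orbit (coAd E G) α) d) (hσ : IsKKSForm α d σ)
    (Φ : M ≃ₘ^∞⟮𝓡 d', 𝓡 d⟯ orbit (coAd E G) α) :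
    (TwoForm.pullback (E := EuclideanSpace ℝ (Fin d')) Φ σ).IsSymplectic := by
  have key : ∀ x : M, ∀ y ∈ (extChartAt (𝓡 d') x).target,
      ContDiffAt ℝ ∞ ((TwoForm.pullback (E := EuclideanSpace ℝ (Fin d')) Φ σ).inChart x) y ∧
        extDeriv ((TwoForm.pullback (E := EuclideanSpace ℝ (Fin d')) Φ σ).inChart x) y = 0 := by
    intro x y hy
    have hΨ : ∀ᶠ z in 𝓝 y, ContMDiffAt (𝓡 d') (𝓡 d') ∞ (extChartAt (𝓡 d') x).symm z := by
      filter_upwards [(isOpen_extChartAt_target (I := 𝓡 d') x).mem_nhds hy] with z hz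
      exact (contMDiffOn_extChartAt_symm (I := 𝓡 d') x).contMDiffAt
        ((isOpen_extChartAt_target (I := 𝓡 d') x).mem_nhds hz)
    refine hσ.contDiffAt_and_extDeriv_eq_zero hG hS
      (Ψ := fun z => Φ ((extChartAt (𝓡 d') x).symm z)) ?_ ?_
    · filter_upwards [hΨ] with z hz
      exact Φ.contMDiff.contMDiffAt.comp z hz
    · filter_upwards [hΨ] with z hz b c
      have h1 := mfderiv_comp z (Φ.contMDiff.contMDiffAt.mdifferentiableAt (by simp))
        (hz.mdifferentiableAt (by simp))
      have h2 := fun b => ContinuousLinearMap.ext_iff.1 h1 b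
      change σ _ _ = σ _ _
      congr 1
      ext1 i
      fin_cases i
      · exact (h2 b).symm
      · exact (h2 c).symm
  refine ⟨fun x y hy => (key x y hy).1.contDiffWithinAt, fun x y hy => (key x y hy).2, ?_⟩
  intro p u hu
  let D := Φ.mfderivToContinuousLinearEquiv (by simp) p
  have h1 : D u = 0 := by
    refine hσ.nondegenerate hS (Φ p) (D u) fun v => ?_
    have h2 := hu (D.symm v)
    have h3 : σ (Φ p) ![D u, D (D.symm v)] = 0 := by
      refine Eq.trans ?_ h2
      change σ _ _ = σ _ _
      congr 1
      ext1 i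
      fin_cases i <;> rfl
    rwa [D.apply_symm_apply] at h3
  exact D.injective (h1.trans (map_zero D).symm)

theorem IsKKSForm.isSymplectic (hG : Function.Surjective (killingFlat E G))
    (hS : IsSubmanifoldStructure (orbit (coAd E G) α) d) (hσ : IsKKSForm α d σ) :
    σ.IsSymplectic := by
  have := hS.1
  have h := hσ.isSymplectic_pullback hG hS (Diffeomorph.refl (𝓡 d) (orbit (coAd E G) α) ∞)
  have h1 : TwoForm.pullback (Diffeomorph.refl (𝓡 d) (orbit (coAd E G) α) ∞) σ = σ := by
    funext p
    ext v
    change σ p _ = σ p v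
    congr 1
    ext1 i
    exact ContinuousLinearMap.ext_iff.1 (mfderiv_id (I := 𝓡 d) (x := p)) (v i)
  rwa [h1] at h

end KirillovKostantSouriau

/-! ### Diffeology of orbit spaces -/

section OrbitSpaces

variable {G : Type*} [Group G] {V : Type*} [NormedAddCommGroup V] [NormedSpace ℝ V]
  {W : Type*} [NormedAddCommGroup W] [NormedSpace ℝ W]
  {ρ : G →* (V →L[ℝ] V)} {ρ' : G →* (W →L[ℝ] W)}

/-- The diffeology pulled back along a map: its plots are the maps whose composition is a plot. -/
@[reducible]
noncomputable def pullbackDiffeology {X Y : Type*} [DiffeologicalSpace Y] (f : X → Y) :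
    DiffeologicalSpace X where
  plots n := {p | IsPlot (f ∘ p)}
  constant_plots x := DiffeologicalSpace.constant_plots (f x)
  plot_reparam hp hf := DiffeologicalSpace.plot_reparam (X := Y) hp hf
  locality h := DiffeologicalSpace.locality (X := Y) h

/-- A map of orbit spaces covered by a smooth map is smooth. -/
theorem dSmooth_orbitSpace_map {f : OrbitSpace ρ → OrbitSpace ρ'} {L : V → W}
    (hL : ContDiff ℝ ∞ L) (hf : ∀ v, f (OrbitSpace.mk ρ v) = OrbitSpace.mk ρ' (L v)) :
    DSmooth f := by
  intro n p hp
  -- A plot of the generated diffeology is a plot of every diffeology containing the generators, so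
  -- it is enough that the pulled back one contains them.
  refine hp (pullbackDiffeology f) ?_
  rintro ⟨m, r⟩ ⟨q, hq, hr⟩ d hd
  have hr' : r = OrbitSpace.mk ρ ∘ q := hr
  rw [hr']
  refine hd ⟨L ∘ q, hL.comp hq, ?_⟩
  ext1 t
  exact hf (q t)

/-- An equivariant linear isomorphism descends to a diffeomorphism of the orbit spaces. -/
theorem exists_orbitSpace_equiv (L : V ≃L[ℝ] W) (hL : ∀ g v, L (ρ g v) = ρ' g (L v)) :
    ∃ f : OrbitSpace ρ ≃ OrbitSpace ρ',
      (∀ v, f (OrbitSpace.mk ρ v) = OrbitSpace.mk ρ' (L v)) ∧ DSmooth f ∧ DSmooth f.symm := by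
  have h : ∀ v w, (orbitSetoid ρ).r v w ↔ (orbitSetoid ρ').r (L v) (L w) := by
    intro v w
    constructor
    · rintro ⟨g, rfl⟩
      exact ⟨g, (hL g v).symm⟩
    · rintro ⟨g, hg⟩
      exact ⟨g, L.injective ((hL g v).trans hg)⟩
  let f : OrbitSpace ρ ≃ OrbitSpace ρ' := Quotient.congr L.toEquiv h
  have hf : ∀ v, f (OrbitSpace.mk ρ v) = OrbitSpace.mk ρ' (L v) := fun _ => rfl
  refine ⟨f, hf, dSmooth_orbitSpace_map L.contDiff hf,
    dSmooth_orbitSpace_map L.symm.contDiff fun w => ?_⟩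
  rw [Equiv.symm_apply_eq, hf, L.apply_symm_apply]

end OrbitSpaces

/-! ### Assembly of the theorem -/

theorem theorem5p0p2
    {E : Type*} [NormedAddCommGroup E] [NormedSpace ℝ E] [FiniteDimensional ℝ E] [CompleteSpace E]
    {G : Type*} [TopologicalSpace G] [ChartedSpace E G] [Group G] [LieGroup 𝓘(ℝ, E) ∞ G]
    [T2Space G] [CompactSpace G] [ConnectedSpace G]
    (hG : (killingForm ℝ (GroupLieAlgebra 𝓘(ℝ, E) G)).Nondegenerate) :
    -- `B♭` is an equivariant linear isomorphism
    Function.Bijective (killingFlat E G) ∧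
    (∀ (g : G) (X : GroupLieAlgebra 𝓘(ℝ, E) G),
      killingFlat E G (Ad E G g X) = coAd E G g (killingFlat E G X)) ∧
    -- it descends to a diffeomorphism of the orbit spaces
    (∃ Bhat : OrbitSpace (Ad E G) ≃ OrbitSpace (coAd E G),
      (∀ X, Bhat (OrbitSpace.mk (Ad E G) X) = OrbitSpace.mk (coAd E G) (killingFlat E G X)) ∧
      DSmooth Bhat ∧ DSmooth Bhat.symm) ∧
    -- and it restricts to a symplectomorphism of every adjoint orbit onto its coadjoint orbit
    ∀ X : GroupLieAlgebra 𝓘(ℝ, E) G,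
      IsEmbeddedSubmanifold (orbit (Ad E G) X) ∧
      IsEmbeddedSubmanifold (orbit (coAd E G) (killingFlat E G X)) ∧
      ∀ (d d' : ℕ) [ChartedSpace (EuclideanSpace ℝ (Fin d)) (orbit (Ad E G) X)]
        [ChartedSpace (EuclideanSpace ℝ (Fin d')) (orbit (coAd E G) (killingFlat E G X))],
        IsSubmanifoldStructure (orbit (Ad E G) X) d →
        IsSubmanifoldStructure (orbit (coAd E G) (killingFlat E G X)) d' →
        (∀ ν : orbit (coAd E G) (killingFlat E G X),
          Set.range (tangentInclusion _ d' ν) =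
            Set.range fun ξ : GroupLieAlgebra 𝓘(ℝ, E) G => fundamentalField (coAd E G) ξ ν.1) ∧
        ∃ (F : orbit (Ad E G) X ≃ₘ^∞⟮𝓡 d, 𝓡 d'⟯ orbit (coAd E G) (killingFlat E G X))
          (σ : TwoForm (EuclideanSpace ℝ (Fin d')) (orbit (coAd E G) (killingFlat E G X)))
          (Ω : TwoForm (EuclideanSpace ℝ (Fin d)) (orbit (Ad E G) X)),
          (∀ Y : orbit (Ad E G) X, (F Y).1 = killingFlat E G Y.1) ∧
          IsKKSForm (killingFlat E G X) d' σ ∧ σ.IsSymplectic ∧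
          Ω.IsSymplectic ∧ IsSymplectomorphism F Ω σ := by
  have hb := killingFlat_bijective hG
  let L : GroupLieAlgebra 𝓘(ℝ, E) G ≃L[ℝ] StrongDual ℝ (GroupLieAlgebra 𝓘(ℝ, E) G) :=
    (LinearEquiv.ofBijective (killingFlat E G) hb).toContinuousLinearEquiv
  have hL : ∀ Y, L Y = killingFlat E G Y := fun _ => rfl
  have hLeq : ∀ g Y, L (Ad E G g Y) = coAd E G g (L Y) := killingFlat_Ad
  refine ⟨hb, killingFlat_Ad, exists_orbitSpace_equiv L hLeq, fun X =>
    ⟨isEmbeddedSubmanifold_orbit contMDiff_Ad X, isEmbeddedSubmanifold_orbit contMDiff_coAd _, ?_⟩⟩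
  intro d d' _ _ hS hS'
  refine ⟨range_tangentInclusion_orbit contMDiff_coAd hS', ?_⟩
  obtain ⟨F, hF⟩ := exists_diffeomorph_of_continuousLinearEquiv hS hS' L
    (by
      rintro _ ⟨g, rfl⟩
      exact ⟨g, (hLeq g X).symm⟩)
    (by
      rintro _ ⟨g, rfl⟩
      refine ⟨g, ?_⟩
      rw [ContinuousLinearEquiv.eq_symm_apply]
      exact hLeq g X)
  obtain ⟨σ, hσ⟩ := exists_isKKSForm hS'
  have := hS.1
  exact ⟨F, σ, TwoForm.pullback F σ, hF, hσ, hσ.isSymplectic hb.2 hS',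
    hσ.isSymplectic_pullback hb.2 hS' F, rfl⟩
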